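/- Let $\mathbb{N}=\{1,2,\dots\}$. For a function $f:\mathbb{N}\to\mathbb{Z}$ put $m_f(n)=\log(1+n)+\log(2+|f(n)|)$. Call $f$ a \emph{PIO function} (polynomial in input and output) if there are constants $c,d\in\mathbb{N}$ and a multitape Turing machine that, for every input $n\in\mathbb{N}$ written in binary, computes the binary code of $f(n)$ in at most $c\cdot m_f(n)^d$ steps. For $n\in\mathbb{N}$ let $P(n)$ be the set of partitions of $n$, and for $\lambda\in P(n)$ let $\|\lambda\|$ be the number of parts of $\lambda$, counted with multiplicity. Proposition. If $g:\mathbb{N}\to\mathbb{N}$ is a PIO function, then the function $f:\mathbb{N}\to\mathbb{N}$ given by $$f(n)=\sum_{\lambda\in P(n)}g(\|\lambda\|)$$ is a PIO function too. -/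

import Mathlib

/-- The binary code of an integer: a sign bit (`true` for negative integers), followed by
the binary digits of the absolute value, least significant digit first. -/
def encodeInt (z : ℤ) : List Bool :=
  decide (z < 0) :: Computability.encodeNat z.natAbs

/-- The combined complexity `m_f(n) = log (1 + n) + log (2 + |f n|)` of input and output. -/
noncomputable def pioSize (f : ℕ+ → ℤ) (n : ℕ+) : ℝ :=
  Real.log (1 + ((n : ℕ) : ℝ)) + Real.log (2 + |(f n : ℝ)|)

/-- A counting function `f` on the positive integers is a *PIO function* if some Turing machine,
for some positive integers `c, d`, computes `f n` from `n` (both written in binary) in at most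
`c * m_f(n) ^ d` steps, for every `n`.

The machines are Mathlib's `Turing.FinTM2`: finitely many labels, internal states and stacks, with
one input stack and one output stack. A stack is a tape that is blank beyond its head, a two-way
tape is a pair of stacks, and a step performs a bounded number of stack operations; so these
machines and multitape Turing machines simulate one another with constant-factor overhead.
All stack alphabets are required to be finite. -/
def IsPIO (f : ℕ+ → ℤ) : Prop :=
  ∃ (M : Turing.TM2ComputableAux Bool Bool) (c d : ℕ), 0 < c ∧ 0 < d ∧
    (∀ k, Finite (M.tm.Γ k)) ∧
    ∀ n : ℕ+, ∃ t : ℕ, (t : ℝ) ≤ c * pioSize f n ^ d ∧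
      Nonempty (Turing.TM2OutputsInTime M.tm
        ((Computability.encodeNat n).map M.inputAlphabet.symm)
        (some ((encodeInt (f n)).map M.outputAlphabet.symm)) t)

/-- The number of parts `‖p‖` of a partition `p` of a positive integer; it is positive. -/
def numParts {n : ℕ+} (p : Nat.Partition n) : ℕ+ :=
  ⟨p.parts.card, by
    rw [Multiset.card_pos]
    intro h
    have hs := p.parts_sum
    rw [h, Multiset.sum_zero] at hs
    exact n.pos.ne hs⟩

/-! Write p(m, k) for the number of partitions of m into k parts. Then f(n) = ∑ g(k) p(n, k) is the
coefficient of x^n in ∑_{k ≥ 1} g(k) x^k / ((1 - x) ⋯ (1 - x^k)). Horner's rule evaluates this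
series by the steps A ← (A + g(j) x^j) / (1 - x^j) for j = n, ..., 1, starting from A = 0. Modulo
x^(n+1), division by 1 - x^j is multiplication by ∑_{t ≤ n} x^(jt), so A stays a polynomial
(`partCount_succ_succ`, `partSeries_succ`, `dvd_arrPoly_sub`, `coeff_arrPoly`).

The machine stores A as the single integer A(2^B). Multiplication by x^j is then a shift by Bj bits,
and a Horner step consists of shifts and additions. B is chosen so large that the coefficients up to
index n stay below 2^B (`sum_lt_two_pow_widthAt`). Higher coefficients may overflow, but their
carries only move upwards, so the coefficient of x^n can be read off in binary
(`Polynomial.eval_div_pow_mod`).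

All this takes time polynomial in n and in the cost of computing g(1), ..., g(n). Although n is
given in binary, this is affordable: since g ≥ 1, f(n) is at least the number of partitions of n,
hence at least 2^(√n - 1) (`two_pow_sqrt_le_card_partition`), and n is bounded by a multiple of
m_f(n)^2. Moreover g(j) ≤ f(n) for j ≤ n, because some partition of n has j parts
(`exists_partition_card_eq`); so each call of the machine for g costs a polynomial in m_f(n).

The machine is assembled from fragments with explicit step bounds. The given machine runs as a
subroutine on stacks of its own (`call_runs`). It can be called repeatedly, since a halting run
restores its registers and leaves nothing but the output on its stacks. -/

/-! ## Stack machine fragments -/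

open Turing

/-- `StepsTo f n a b`: iterating the partial function `f` exactly `n` times leads from `a` to `b`. -/
inductive StepsTo {α : Type*} (f : α → Option α) : ℕ → α → α → Prop
  | refl (a : α) : StepsTo f 0 a a
  | head {n : ℕ} {a b c : α} : f a = some b → StepsTo f n b c → StepsTo f (n + 1) a c

namespace StepsTo

variable {α β : Type*} {f : α → Option α}

theorem trans {m n : ℕ} {a b c : α} (h : StepsTo f m a b) (h' : StepsTo f n b c) :
    StepsTo f (m + n) a c := by
  induction h with
  | refl => simpa using h'
  | head hab _ ih => rw [Nat.add_right_comm]; exact head hab (ih h')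

theorem single {a b : α} (h : f a = some b) : StepsTo f 1 a b := head h (refl b)

theorem iterate_none (n : ℕ) : (flip bind f)^[n] (none : Option α) = none := by
  induction n with
  | zero => rfl
  | succ n ih => rw [Function.iterate_succ_apply]; exact ih

/-- This is the form in which `Turing.EvalsTo` counts steps; it is needed only for passing between
fragments and complete machines. -/
theorem iff_iterate {n : ℕ} {a b : α} :
    StepsTo f n a b ↔ (flip bind f)^[n] (some a) = some b := by
  constructor
  · intro h
    induction h with
    | refl => rfl
    | @head n a b c hab _ ih =>
      rw [Function.iterate_succ_apply]
      have : flip bind f (some a) = some b := hab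
      rw [this, ih]
  · induction n generalizing a with
    | zero => intro h; cases h; exact refl _
    | succ n ih =>
      intro h
      rw [Function.iterate_succ_apply] at h
      have e : flip bind f (some a) = f a := rfl
      rw [e] at h
      cases hfa : f a with
      | none => rw [hfa, iterate_none] at h; cases h
      | some a' => rw [hfa] at h; exact head hfa (ih h)

theorem map {g : β → Option β} (φ : α → β) (hφ : ∀ a b, f a = some b → g (φ a) = some (φ b))
    {n : ℕ} {a b : α} (h : StepsTo f n a b) : StepsTo g n (φ a) (φ b) := by
  induction h with
  | refl => exact refl _
  | head hab _ ih => exact head (hφ _ _ hab) ih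

end StepsTo

/-! ### Redirecting jumps and exits of stack machine code -/

section Subst

variable {K : Type} {Γ : K → Type} {Λ L σ : Type}

/-- Relabel the jumps of a statement by `f` and replace `halt` by the statement `h`. -/
def substStmt (f : Λ → L) (h : TM2.Stmt Γ L σ) : TM2.Stmt Γ Λ σ → TM2.Stmt Γ L σ
  | .push k g q => .push k g (substStmt f h q)
  | .peek k g q => .peek k g (substStmt f h q)
  | .pop k g q => .pop k g (substStmt f h q)
  | .load g q => .load g (substStmt f h q)
  | .branch p q₁ q₂ => .branch p (substStmt f h q₁) (substStmt f h q₂)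
  | .goto l => .goto fun v => f (l v)
  | .halt => h

variable [DecidableEq K]

/-- The configuration reached by a statement changed by `substStmt`, given the configuration
reached by the original one. -/
def substCfg (f : Λ → L) (h : TM2.Stmt Γ L σ) : TM2.Cfg Γ Λ σ → TM2.Cfg Γ L σ
  | ⟨some l, v, S⟩ => ⟨some (f l), v, S⟩
  | ⟨none, v, S⟩ => TM2.stepAux h v S

theorem stepAux_substStmt (f : Λ → L) (h : TM2.Stmt Γ L σ) (q : TM2.Stmt Γ Λ σ) (v : σ)
    (S : ∀ k, List (Γ k)) :
    TM2.stepAux (substStmt f h q) v S = substCfg f h (TM2.stepAux q v S) := by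
  induction q generalizing v S with
  | branch p q₁ q₂ ih₁ ih₂ =>
    simp only [substStmt, TM2.stepAux]
    cases p v <;> simp [ih₁, ih₂]
  | goto l => rfl
  | halt => rfl
  | _ => simp_all [substStmt]

/-- The substituted statement is executed within the step that would have halted, so redirecting the
exit costs no additional step. -/
theorem StepsTo.substStmt {M : Λ → TM2.Stmt Γ Λ σ} {N : L → TM2.Stmt Γ L σ} {f : Λ → L}
    {h : TM2.Stmt Γ L σ} (hN : ∀ l, N (f l) = substStmt f h (M l)) {n : ℕ} {l : Λ} {v v' : σ}
    {S S' : ∀ k, List (Γ k)} (H : StepsTo (TM2.step M) n ⟨some l, v, S⟩ ⟨none, v', S'⟩) :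
    StepsTo (TM2.step N) n ⟨some (f l), v, S⟩ (TM2.stepAux h v' S') := by
  generalize ha : (⟨some l, v, S⟩ : TM2.Cfg Γ Λ σ) = a at H
  generalize hb : (⟨none, v', S'⟩ : TM2.Cfg Γ Λ σ) = b at H
  induction H generalizing l v S with
  | refl => subst ha; cases hb
  | @head n a c d hac hcd ih =>
    subst ha
    simp only [TM2.step, Option.some.injEq] at hac
    have e : TM2.step N ⟨some (f l), v, S⟩ = some (substCfg f h c) := by
      simp only [TM2.step, hN, stepAux_substStmt, hac]
    refine StepsTo.head e ?_
    obtain ⟨_ | l', w, T⟩ := c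
    -- A halted configuration has no successor, so here the run is already complete.
    · cases hcd with
      | refl => cases hb; exact StepsTo.refl _
      | head h₁ _ => cases h₁
    · exact ih rfl hb

end Subst

/-- A program fragment for a stack machine: a machine with a designated first label, whose halting
statements are thought of as exits. -/
structure Frag {K : Type} (Γ : K → Type) (σ : Type) where
  /-- the labels of the fragment -/
  Λ : Type
  /-- there are finitely many labels -/
  fin : Fintype Λ
  /-- the entry label -/
  main : Λ
  /-- the code -/
  m : Λ → TM2.Stmt Γ Λ σ

namespace Frag

variable {K : Type} {Γ : K → Type} {σ : Type}

/-- The fragment consisting of a single statement, which may jump back to its beginning. -/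
def atom (q : TM2.Stmt Γ Unit σ) : Frag Γ σ := ⟨Unit, inferInstance, (), fun _ => q⟩

/-- Execute one fragment after the other. -/
def seq (F G : Frag Γ σ) : Frag Γ σ where
  Λ := F.Λ ⊕ G.Λ
  fin := @instFintypeSum _ _ F.fin G.fin
  main := Sum.inl F.main
  m := Sum.elim (fun l => substStmt Sum.inl (.goto fun _ => Sum.inr G.main) (F.m l))
    (fun l => substStmt Sum.inr .halt (G.m l))

/-- Execute the test, which may either exit or jump; as long as it jumps, execute the body and
repeat. -/
def loop (test : TM2.Stmt Γ Unit σ) (F : Frag Γ σ) : Frag Γ σ where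
  Λ := Option F.Λ
  fin := @instFintypeOption _ F.fin
  main := none
  m
  | none => substStmt (fun _ => some F.main) .halt test
  | some l => substStmt some (.goto fun _ => none) (F.m l)

variable [DecidableEq K]

/-- The fragment `F`, started with registers `v` and stacks `S`, exits with registers `v'` and
stacks `S'` after at most `t` steps. -/
def RunsFrom (F : Frag Γ σ) (v : σ) (S : ∀ k, List (Γ k)) (v' : σ) (S' : ∀ k, List (Γ k))
    (t : ℕ) : Prop :=
  ∃ n ≤ t, StepsTo (TM2.step F.m) n ⟨some F.main, v, S⟩ ⟨none, v', S'⟩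

/-- The fragment `F`, started with default registers and stacks `S`, exits with default registers
and stacks `S'` after at most `t` steps. -/
def Runs [Inhabited σ] (F : Frag Γ σ) (S S' : ∀ k, List (Γ k)) (t : ℕ) : Prop :=
  F.RunsFrom default S default S' t

variable {F G : Frag Γ σ} {v v' v'' : σ} {S S' S'' : ∀ k, List (Γ k)} {t t' : ℕ}

theorem atom_exit {q : TM2.Stmt Γ Unit σ} (h : TM2.stepAux q v S = ⟨none, v', S'⟩) :
    (atom q).RunsFrom v S v' S' 1 :=
  ⟨1, le_rfl, StepsTo.single (congrArg some h)⟩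

theorem atom_repeat {q : TM2.Stmt Γ Unit σ} (h : TM2.stepAux q v S = ⟨some (), v', S'⟩)
    (h' : (atom q).RunsFrom v' S' v'' S'' t) : (atom q).RunsFrom v S v'' S'' (t + 1) := by
  obtain ⟨n, hn, H⟩ := h'
  exact ⟨n + 1, by omega, StepsTo.head (congrArg some h) H⟩

theorem RunsFrom.mono (h : F.RunsFrom v S v' S' t) (ht : t ≤ t') : F.RunsFrom v S v' S' t' := by
  obtain ⟨n, hn, H⟩ := h
  exact ⟨n, hn.trans ht, H⟩

theorem RunsFrom.seq (h : F.RunsFrom v S v' S' t) (h' : G.RunsFrom v' S' v'' S'' t') :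
    (F.seq G).RunsFrom v S v'' S'' (t + t') := by
  obtain ⟨n, hn, H⟩ := h
  obtain ⟨n', hn', H'⟩ := h'
  refine ⟨n + n', by omega, ?_⟩
  have h₁ := H.substStmt (N := (F.seq G).m) (f := Sum.inl)
    (h := .goto fun _ => Sum.inr G.main) (fun _ => rfl)
  have h₂ := H'.substStmt (N := (F.seq G).m) (f := Sum.inr) (h := .halt) (fun _ => rfl)
  exact h₁.trans h₂

theorem loop_exit {test : TM2.Stmt Γ Unit σ} (h : TM2.stepAux test v S = ⟨none, v', S'⟩) :
    (loop test F).RunsFrom v S v' S' 1 :=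
  ⟨1, le_rfl, StepsTo.single <| congrArg some <|
    (stepAux_substStmt (fun _ => some F.main) .halt test v S).trans (by rw [h]; rfl)⟩

theorem loop_repeat {test : TM2.Stmt Γ Unit σ} {v₁ v₂ : σ} {S₁ S₂ : ∀ k, List (Γ k)}
    (h : TM2.stepAux test v S = ⟨some (), v₁, S₁⟩) (h' : F.RunsFrom v₁ S₁ v₂ S₂ t)
    (h'' : (loop test F).RunsFrom v₂ S₂ v' S' t') :
    (loop test F).RunsFrom v S v' S' (t + t' + 1) := by
  obtain ⟨n, hn, H⟩ := h'
  obtain ⟨n', hn', H'⟩ := h''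
  refine ⟨n + n' + 1, by omega, StepsTo.head (b := ⟨some (some F.main), v₁, S₁⟩) ?_ ?_⟩
  · exact congrArg some <|
      (stepAux_substStmt (fun _ => some F.main) .halt test v S).trans (by rw [h]; rfl)
  · exact (H.substStmt (N := (loop test F).m) (f := some) (h := .goto fun _ => none)
      (fun _ => rfl)).trans H'

section Default

variable [Inhabited σ]

theorem Runs.mono (h : F.Runs S S' t) (ht : t ≤ t') : F.Runs S S' t' := RunsFrom.mono h ht

theorem Runs.seq (h : F.Runs S S' t) (h' : G.Runs S' S'' t') : (F.seq G).Runs S S'' (t + t') :=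
  RunsFrom.seq h h'

/-- `A i` and `B i` are the stacks before and after the test of round `i`. Each of the `n` rounds
costs the body and one test, and the failing test at the end costs one more step. -/
theorem Runs.loop {test : TM2.Stmt Γ Unit σ} (n : ℕ) (A B : ℕ → ∀ k, List (Γ k))
    (htest : ∀ i < n, TM2.stepAux test default (A i) = ⟨some (), default, B i⟩)
    (hbody : ∀ i < n, F.Runs (B i) (A (i + 1)) t)
    (hexit : TM2.stepAux test default (A n) = ⟨none, default, S⟩) :
    (loop test F).Runs (A 0) S (n * (t + 1) + 1) := by
  induction n generalizing A B with
  | zero => exact (loop_exit hexit).mono (by omega)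
  | succ n ih =>
    refine RunsFrom.mono (loop_repeat (htest 0 n.succ_pos) (hbody 0 n.succ_pos)
      (ih (fun i => A (i + 1)) (fun i => B (i + 1)) (fun i hi => htest _ (by omega))
        (fun i hi => hbody _ (by omega)) hexit)) ?_
    rw [Nat.succ_mul]; omega

end Default

end Frag

/-! ## Running two machines side by side -/

section Join

variable {K₁ K₂ : Type} {Γ₁ : K₁ → Type} {Γ₂ : K₂ → Type} {σ₁ σ₂ Λ : Type}

/-- The stacks of two machines, put together. -/
def joinStacks (y : ∀ k, List (Γ₁ k)) (x : ∀ k, List (Γ₂ k)) :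
    ∀ k, List (Sum.elim Γ₁ Γ₂ k)
  | .inl k => y k
  | .inr k => x k

/-- A statement of the first of two machines, as a statement of the joint machine. -/
def liftLeft : TM2.Stmt Γ₁ Λ σ₁ → TM2.Stmt (Sum.elim Γ₁ Γ₂) Λ (σ₁ × σ₂)
  | .push k g q => .push (.inl k) (fun v => g v.1) (liftLeft q)
  | .peek k g q => .peek (.inl k) (fun v a => (g v.1 a, v.2)) (liftLeft q)
  | .pop k g q => .pop (.inl k) (fun v a => (g v.1 a, v.2)) (liftLeft q)
  | .load g q => .load (fun v => (g v.1, v.2)) (liftLeft q)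
  | .branch p q₁ q₂ => .branch (fun v => p v.1) (liftLeft q₁) (liftLeft q₂)
  | .goto l => .goto fun v => l v.1
  | .halt => .halt

/-- A statement of the second of two machines, as a statement of the joint machine. -/
def liftRight : TM2.Stmt Γ₂ Λ σ₂ → TM2.Stmt (Sum.elim Γ₁ Γ₂) Λ (σ₁ × σ₂)
  | .push k g q => .push (.inr k) (fun v => g v.2) (liftRight q)
  | .peek k g q => .peek (.inr k) (fun v a => (v.1, g v.2 a)) (liftRight q)
  | .pop k g q => .pop (.inr k) (fun v a => (v.1, g v.2 a)) (liftRight q)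
  | .load g q => .load (fun v => (v.1, g v.2)) (liftRight q)
  | .branch p q₁ q₂ => .branch (fun v => p v.2) (liftRight q₁) (liftRight q₂)
  | .goto l => .goto fun v => l v.2
  | .halt => .halt

variable [DecidableEq K₁] [DecidableEq K₂]

theorem update_joinStacks_inl (y : ∀ k, List (Γ₁ k)) (x : ∀ k, List (Γ₂ k)) (k : K₁)
    (l : List (Γ₁ k)) :
    Function.update (joinStacks y x) (.inl k) l = joinStacks (Function.update y k l) x := by
  funext j
  rcases j with j | j
  · by_cases h : j = k
    · subst h
      exact (Function.update_self ..).trans (Function.update_self (β := fun k => List (Γ₁ k)) ..).symm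
    · exact (Function.update_of_ne (by simpa using h) ..).trans
        (Function.update_of_ne (β := fun k => List (Γ₁ k)) h ..).symm
  · exact Function.update_of_ne (by simp) ..

theorem update_joinStacks_inr (y : ∀ k, List (Γ₁ k)) (x : ∀ k, List (Γ₂ k)) (k : K₂)
    (l : List (Γ₂ k)) :
    Function.update (joinStacks y x) (.inr k) l = joinStacks y (Function.update x k l) := by
  funext j
  rcases j with j | j
  · exact Function.update_of_ne (by simp) ..
  · by_cases h : j = k
    · subst h
      exact (Function.update_self ..).trans (Function.update_self (β := fun k => List (Γ₂ k)) ..).symm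
    · exact (Function.update_of_ne (by simpa using h) ..).trans
        (Function.update_of_ne (β := fun k => List (Γ₂ k)) h ..).symm

/-- A configuration of the first machine, together with registers and stacks of the second. -/
def joinLeft (w : σ₂) (x : ∀ k, List (Γ₂ k)) (c : TM2.Cfg Γ₁ Λ σ₁) :
    TM2.Cfg (Sum.elim Γ₁ Γ₂) Λ (σ₁ × σ₂) := ⟨c.l, (c.var, w), joinStacks c.stk x⟩

/-- A configuration of the second machine, together with registers and stacks of the first. -/
def joinRight (w : σ₁) (y : ∀ k, List (Γ₁ k)) (c : TM2.Cfg Γ₂ Λ σ₂) :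
    TM2.Cfg (Sum.elim Γ₁ Γ₂) Λ (σ₁ × σ₂) := ⟨c.l, (w, c.var), joinStacks y c.stk⟩

theorem stepAux_liftLeft (q : TM2.Stmt Γ₁ Λ σ₁) (v : σ₁) (w : σ₂) (y : ∀ k, List (Γ₁ k))
    (x : ∀ k, List (Γ₂ k)) :
    TM2.stepAux (liftLeft q) (v, w) (joinStacks y x) = joinLeft w x (TM2.stepAux q v y) := by
  induction q generalizing v y with
  | branch p q₁ q₂ ih₁ ih₂ =>
    simp only [liftLeft, TM2.stepAux]
    cases p v <;> simp [ih₁, ih₂]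
  | goto l => rfl
  | halt => rfl
  | push k g q ih =>
    simp only [liftLeft, TM2.stepAux]
    exact (congrArg _ (update_joinStacks_inl y x k _)).trans (ih _ _)
  | pop k g q ih =>
    simp only [liftLeft, TM2.stepAux]
    exact (congrArg _ (update_joinStacks_inl y x k _)).trans (ih _ _)
  | peek k g q ih => exact ih _ _
  | load g q ih => exact ih _ _

theorem stepAux_liftRight (q : TM2.Stmt Γ₂ Λ σ₂) (v : σ₂) (w : σ₁) (y : ∀ k, List (Γ₁ k))
    (x : ∀ k, List (Γ₂ k)) :
    TM2.stepAux (liftRight q) (w, v) (joinStacks y x) = joinRight w y (TM2.stepAux q v x) := by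
  induction q generalizing v x with
  | branch p q₁ q₂ ih₁ ih₂ =>
    simp only [liftRight, TM2.stepAux]
    cases p v <;> simp [ih₁, ih₂]
  | goto l => rfl
  | halt => rfl
  | push k g q ih =>
    simp only [liftRight, TM2.stepAux]
    exact (congrArg _ (update_joinStacks_inr y x k _)).trans (ih _ _)
  | pop k g q ih =>
    simp only [liftRight, TM2.stepAux]
    exact (congrArg _ (update_joinStacks_inr y x k _)).trans (ih _ _)
  | peek k g q ih => exact ih _ _
  | load g q ih => exact ih _ _

namespace Frag

/-- A fragment of the first of two machines, as a fragment of the joint machine. -/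
def left (F : Frag Γ₁ σ₁) : Frag (Sum.elim Γ₁ Γ₂) (σ₁ × σ₂) :=
  ⟨F.Λ, F.fin, F.main, fun l => liftLeft (F.m l)⟩

/-- A fragment of the second of two machines, as a fragment of the joint machine. -/
def right (F : Frag Γ₂ σ₂) : Frag (Sum.elim Γ₁ Γ₂) (σ₁ × σ₂) :=
  ⟨F.Λ, F.fin, F.main, fun l => liftRight (F.m l)⟩

variable [Inhabited σ₁] [Inhabited σ₂]

theorem Runs.left {F : Frag Γ₁ σ₁} {y y' : ∀ k, List (Γ₁ k)} {t : ℕ} (h : F.Runs y y' t)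
    (x : ∀ k, List (Γ₂ k)) :
    (F.left (σ₂ := σ₂)).Runs (joinStacks y x) (joinStacks y' x) t := by
  obtain ⟨n, hn, H⟩ := h
  refine ⟨n, hn, H.map (joinLeft default x) ?_⟩
  rintro ⟨_ | l, v, S⟩ b hb
  · cases hb
  · cases hb
    exact congrArg some (stepAux_liftLeft _ _ _ _ _)

theorem Runs.right {F : Frag Γ₂ σ₂} {x x' : ∀ k, List (Γ₂ k)} {t : ℕ} (h : F.Runs x x' t)
    (y : ∀ k, List (Γ₁ k)) :
    (F.right (σ₁ := σ₁)).Runs (joinStacks y x) (joinStacks y x') t := by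
  obtain ⟨n, hn, H⟩ := h
  refine ⟨n, hn, H.map (joinRight default y) ?_⟩
  rintro ⟨_ | l, v, S⟩ b hb
  · cases hb
  · cases hb
    exact congrArg some (stepAux_liftRight _ _ _ _ _)

end Frag

end Join

/-! ## Basic programs on stacks of bits -/

/-- The registers of our programs: two buffers for bits and a carry bit. -/
abbrev Reg : Type := Option Bool × Option Bool × Bool

/-- Programs on stacks of bits. -/
abbrev BitFrag (W : Type) : Type 1 := Frag (fun _ : W => Bool) Reg

/-- The result of adding two binary numbers (least significant digit first) and a carry bit
digit by digit. -/
def addCarry : Bool → List Bool → List Bool → List Bool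
  | c, [], [] => if c then [true] else []
  | c, x :: xs, [] => xor c x :: addCarry (c && x) xs []
  | c, [], y :: ys => xor c y :: addCarry (c && y) [] ys
  | c, x :: xs, y :: ys =>
    xor c (xor x y) :: addCarry ((x && y) || (c && x) || (c && y)) xs ys
termination_by _ x y => x.length + y.length

/-- The predecessor of a binary number without leading zeros. -/
def bitPred : List Bool → List Bool
  | [] => []
  | false :: l => true :: bitPred l
  | [true] => []
  | true :: b :: l => false :: b :: l

namespace BitFrag

variable {W : Type}

open Function Frag

variable [DecidableEq W]

theorem RunsFrom.congr {F : BitFrag W} {v v' : Reg} {x y z : W → List Bool} {t t' : ℕ}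
    (h : F.RunsFrom v x v' y t) (e : y = z) (ht : t ≤ t') : F.RunsFrom v x v' z t' :=
  e ▸ h.mono ht

/-- Move the contents of stack `a` to stack `b`, reversing their order and applying `f`. -/
def move (a b : W) (f : Bool → Bool) : BitFrag W :=
  atom (Γ := fun _ : W => Bool) (σ := Reg) <| .pop a (fun _ o => (o, none, false)) <|
    .branch (fun r => r.1.isNone) .halt <|
    .push b (fun r => f (r.1.getD false)) <| .load (fun _ => default) <| .goto fun _ => ()

theorem move_runs {a b : W} (hab : a ≠ b) (f : Bool → Bool) (x : W → List Bool) :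
    (move a b f).Runs x (update (update x a []) b ((x a).reverse.map f ++ x b))
      ((x a).length + 1) := by
  generalize h : x a = l
  induction l generalizing x with
  | nil =>
    refine RunsFrom.congr (atom_exit (S' := update x a []) (by simp [TM2.stepAux, h]; rfl)) ?_
      (by simp)
    funext k
    simp [update_apply]
    grind
  | cons c l ih =>
    refine atom_repeat (v' := default) (S' := update (update x a l) b (f c :: x b)) ?_ ?_
    · simp [TM2.stepAux, h, update_of_ne hab.symm]
    · refine RunsFrom.congr (ih (update (update x a l) b (f c :: x b)) ?_) ?_ le_rfl
      · simp [update_of_ne hab]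
      · funext k
        simp [update_apply]
        grind

/-- Move the contents of stack `a` both to stack `b` and to stack `c`, reversing their order and
applying `f` and `g`, respectively. -/
def moveTwo (a b c : W) (f g : Bool → Bool) : BitFrag W :=
  atom (Γ := fun _ : W => Bool) (σ := Reg) <| .pop a (fun _ o => (o, none, false)) <|
    .branch (fun r => r.1.isNone) .halt <|
    .push b (fun r => f (r.1.getD false)) <| .push c (fun r => g (r.1.getD false)) <|
    .load (fun _ => default) <| .goto fun _ => ()

theorem moveTwo_runs {a b c : W} (hab : a ≠ b) (hac : a ≠ c) (hbc : b ≠ c) (f g : Bool → Bool)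
    (x : W → List Bool) :
    (moveTwo a b c f g).Runs x (update (update (update x a []) b ((x a).reverse.map f ++ x b)) c
      ((x a).reverse.map g ++ x c)) ((x a).length + 1) := by
  generalize h : x a = l
  induction l generalizing x with
  | nil =>
    refine RunsFrom.congr (atom_exit (S' := update x a []) (by simp [TM2.stepAux, h]; rfl)) ?_
      (by simp)
    funext k
    simp [update_apply]
    grind
  | cons d l ih =>
    refine atom_repeat (v' := default)
      (S' := update (update (update x a l) b (f d :: x b)) c (g d :: x c)) ?_ ?_
    · simp [TM2.stepAux, h, update_of_ne hab.symm, update_of_ne hac.symm, update_of_ne hbc.symm]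
    · refine RunsFrom.congr (ih _ ?_) ?_ le_rfl
      · simp [update_of_ne hab, update_of_ne hac]
      · funext k
        simp [update_apply]
        grind

/-- Empty stack `a`. -/
def clear (a : W) : BitFrag W :=
  atom (Γ := fun _ : W => Bool) (σ := Reg) <| .pop a (fun _ o => (o, none, false)) <|
    .branch (fun r => r.1.isNone) .halt <| .load (fun _ => default) <| .goto fun _ => ()

theorem clear_runs (a : W) (x : W → List Bool) :
    (clear a).Runs x (update x a []) ((x a).length + 1) := by
  generalize h : x a = l
  induction l generalizing x with
  | nil => exact atom_exit (by simp [TM2.stepAux, h]; rfl)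
  | cons d l ih =>
    refine atom_repeat (v' := default) (S' := update x a l) (by simp [TM2.stepAux, h]) ?_
    exact RunsFrom.congr (ih _ (by simp)) (by simp) le_rfl

/-- Put the bit `d` on stack `a`. -/
def put (a : W) (d : Bool) : BitFrag W :=
  atom (Γ := fun _ : W => Bool) (σ := Reg) <| .push a (fun _ => d) .halt

theorem put_runs (a : W) (d : Bool) (x : W → List Bool) :
    (put a d).Runs x (update x a (d :: x a)) 1 :=
  atom_exit rfl

/-- Remove the top of stack `a`. -/
def drop (a : W) : BitFrag W :=
  atom (Γ := fun _ : W => Bool) (σ := Reg) <| .pop a (fun r _ => r) .halt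

theorem drop_runs (a : W) (x : W → List Bool) :
    (drop a).Runs x (update x a (x a).tail) 1 :=
  atom_exit rfl

/-- Move the contents of stack `a` to stack `b`, and remove as many bits from stack `c`. -/
def moveDrop (a b c : W) : BitFrag W :=
  atom (Γ := fun _ : W => Bool) (σ := Reg) <| .pop a (fun _ o => (o, none, false)) <|
    .branch (fun r => r.1.isNone) .halt <|
    .push b (fun r => r.1.getD false) <| .pop c (fun r _ => r) <|
    .load (fun _ => default) <| .goto fun _ => ()

theorem moveDrop_runs {a b c : W} (hab : a ≠ b) (hac : a ≠ c) (hbc : b ≠ c)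
    (x : W → List Bool) :
    (moveDrop a b c).Runs x (update (update (update x a []) b ((x a).reverse ++ x b)) c
      ((x c).drop (x a).length)) ((x a).length + 1) := by
  generalize h : x a = l
  induction l generalizing x with
  | nil =>
    refine RunsFrom.congr (atom_exit (S' := update x a []) (by simp [TM2.stepAux, h]; rfl)) ?_
      (by simp)
    funext k
    simp [update_apply]
    grind
  | cons d l ih =>
    refine atom_repeat (v' := default)
      (S' := update (update (update x a l) b (d :: x b)) c (x c).tail) ?_ ?_
    · simp [TM2.stepAux, h, update_of_ne hab.symm, update_of_ne hac.symm, update_of_ne hbc.symm]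
    · refine RunsFrom.congr (ih _ ?_) ?_ le_rfl
      · simp [update_of_ne hab, update_of_ne hac]
      · funext k
        simp [update_apply]
        grind

/-- Empty stack `a`, and move as many bits from stack `b` to stack `c` (or all of them). -/
def moveUpTo (a b c : W) : BitFrag W :=
  atom (Γ := fun _ : W => Bool) (σ := Reg) <| .pop a (fun _ o => (o, none, false)) <|
    .branch (fun r => r.1.isNone) .halt <|
    .pop b (fun r o => (r.1, o, false)) <|
    .branch (fun r => r.2.1.isNone) (.load (fun _ => default) <| .goto fun _ => ()) <|
    .push c (fun r => r.2.1.getD false) <| .load (fun _ => default) <| .goto fun _ => ()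

theorem moveUpTo_runs {a b c : W} (hab : a ≠ b) (hac : a ≠ c) (hbc : b ≠ c)
    (x : W → List Bool) :
    (moveUpTo a b c).Runs x (update (update (update x a []) b ((x b).drop (x a).length)) c
      (((x b).take (x a).length).reverse ++ x c)) ((x a).length + 1) := by
  generalize h : x a = l
  induction l generalizing x with
  | nil =>
    refine RunsFrom.congr (atom_exit (S' := update x a []) (by simp [TM2.stepAux, h]; rfl)) ?_
      (by simp)
    funext k
    simp [update_apply]
    grind
  | cons d l ih =>
    cases hb : x b with
    | nil =>
      refine atom_repeat (v' := default) (S' := update x a l) ?_ ?_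
      · simp [TM2.stepAux, h, update_of_ne hab.symm, hb]
      · refine RunsFrom.congr (ih _ ?_) ?_ le_rfl
        · simp
        · funext k
          simp [update_apply]
          grind
    | cons e m =>
      refine atom_repeat (v' := default)
        (S' := update (update (update x a l) b m) c (e :: x c)) ?_ ?_
      · simp [TM2.stepAux, h, update_of_ne hab.symm, update_of_ne hac.symm,
          update_of_ne hbc.symm, hb]
      · refine RunsFrom.congr (ih _ ?_) ?_ le_rfl
        · simp [update_of_ne hab, update_of_ne hac]
        · funext k
          simp [update_apply]
          grind

/-- Remove all zeros from the top of stack `a`. -/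
def trim (a : W) : BitFrag W :=
  atom (Γ := fun _ : W => Bool) (σ := Reg) <| .pop a (fun _ o => (o, none, false)) <|
    .branch (fun r => r.1.isNone) .halt <|
    .branch (fun r => r.1.getD false)
      (.push a (fun _ => true) <| .load (fun _ => default) .halt)
      (.load (fun _ => default) <| .goto fun _ => ())

theorem trim_runs (a : W) (x : W → List Bool) :
    (trim a).Runs x (update x a ((x a).dropWhile (!·))) ((x a).length + 1) := by
  generalize h : x a = l
  induction l generalizing x with
  | nil => exact atom_exit (by simp [TM2.stepAux, h]; rfl)
  | cons d l ih =>
    cases d with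
    | false =>
      refine atom_repeat (v' := default) (S' := update x a l) (by simp [TM2.stepAux, h]) ?_
      exact RunsFrom.congr (ih _ (by simp)) (by simp) le_rfl
    | true =>
      refine RunsFrom.congr (atom_exit (S' := x) ?_) ?_ (by simp)
      · simp [TM2.stepAux, h]
      · rw [List.dropWhile_cons_of_neg (by simp), ← h, update_eq_self]

/-- Add the binary numbers on the stacks `a` and `b`; the sum is put on stack `c`, most significant
digit first, and the second summand is moved to stack `d`. -/
def add (a b c d : W) : BitFrag W :=
  atom (Γ := fun _ : W => Bool) (σ := Reg) <| .pop a (fun r o => (o, none, r.2.2)) <|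
    .pop b (fun r o => (r.1, o, r.2.2)) <|
    .branch (fun r => r.1.isNone && r.2.1.isNone)
      (.branch (fun r => r.2.2) (.push c (fun _ => true) <| .load (fun _ => default) .halt) .halt) <|
    .push c (fun r => xor r.2.2 (xor (r.1.getD false) (r.2.1.getD false))) <|
    .branch (fun r => r.2.1.isSome)
      (.push d (fun r => r.2.1.getD false) <|
        .load (fun r => (none, none, (r.1.getD false && r.2.1.getD false) ||
          (r.2.2 && r.1.getD false) || (r.2.2 && r.2.1.getD false))) <| .goto fun _ => ())
      (.load (fun r => (none, none, r.2.2 && r.1.getD false)) <| .goto fun _ => ())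

/-- The induction needs an arbitrary carry in the register, since each round leaves one for the
next. The second summand is kept because the Horner loop adds the same array again and again. -/
theorem add_runsFrom {a b c d : W} (hab : a ≠ b) (hac : a ≠ c) (had : a ≠ d) (hbc : b ≠ c)
    (hbd : b ≠ d) (hcd : c ≠ d) (r : Bool) (l m : List Bool) (x : W → List Bool)
    (ha : x a = l) (hb : x b = m) :
    (add a b c d).RunsFrom (none, none, r) x default
      (update (update (update (update x a []) b []) c ((addCarry r l m).reverse ++ x c)) d
        (m.reverse ++ x d)) (l.length + m.length + 1) := by
  induction r, l, m using addCarry.induct generalizing x with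
  | case1 =>
    refine RunsFrom.congr (atom_exit (S' := update x c (true :: x c)) ?_) ?_ (by simp)
    · have h₁ : update x a [] = x := by rw [← ha, update_eq_self]
      have h₂ : update x b [] = x := by rw [← hb, update_eq_self]
      simp [TM2.stepAux, ha, hb, h₁, h₂]
    · funext k
      simp [update_apply, addCarry]
      grind
  | case2 r hr =>
    refine RunsFrom.congr (atom_exit (S' := x) ?_) ?_ (by simp)
    · have h₁ : update x a [] = x := by rw [← ha, update_eq_self]
      have h₂ : update x b [] = x := by rw [← hb, update_eq_self]
      simp [TM2.stepAux, ha, hb, h₁, h₂, hr]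
      rfl
    · funext k
      simp [update_apply, addCarry]
      grind
  | case3 r e l ih =>
    refine atom_repeat (v' := (none, none, r && e))
      (S' := update (update x a l) c (xor r e :: x c)) ?_ (RunsFrom.congr (ih _ ?_ ?_) ?_ ?_)
    · have h₂ : update (update x a l) b [] = update x a l := by
        rw [update_comm hab, ← hb, update_eq_self]
      simp [TM2.stepAux, ha, hb, update_of_ne hab.symm, update_of_ne hac.symm, h₂]
    · simp [update_of_ne hac]
    · simp [update_of_ne hab.symm, update_of_ne hbc, hb]
    · funext k
      simp [update_apply, addCarry]
      grind
    · simp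
  | case4 r e l ih =>
    refine atom_repeat (v' := (none, none, r && e))
      (S' := update (update (update x b l) c (xor r e :: x c)) d (e :: x d)) ?_
      (RunsFrom.congr (ih _ ?_ ?_) ?_ ?_)
    · have h₁ : update x a [] = x := by rw [← ha, update_eq_self]
      simp [TM2.stepAux, ha, hb, h₁, update_of_ne hbc.symm, update_of_ne hbd.symm,
        update_of_ne hcd.symm]
    · simp [update_of_ne hac, update_of_ne had, update_of_ne hab, ha]
    · simp [update_of_ne hbc, update_of_ne hbd]
    · funext k
      simp [update_apply, addCarry]
      grind
    · simp
  | case5 r e l f m ih =>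
    refine atom_repeat (v' := (none, none, ((e && f) || (r && e) || (r && f))))
      (S' := update (update (update (update x a l) b m) c (xor r (xor e f) :: x c)) d (f :: x d))
      ?_ (RunsFrom.congr (ih _ ?_ ?_) ?_ ?_)
    · simp [TM2.stepAux, ha, hb, update_of_ne hab.symm, update_of_ne hac.symm,
        update_of_ne had.symm, update_of_ne hbc.symm, update_of_ne hbd.symm, update_of_ne hcd.symm]
    · simp [update_of_ne hac, update_of_ne had, update_of_ne hab]
    · simp [update_of_ne hbc, update_of_ne hbd]
    · funext k
      simp [update_apply, addCarry]
      grind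
    · simp; omega

theorem add_runs {a b c d : W} (hab : a ≠ b) (hac : a ≠ c) (had : a ≠ d) (hbc : b ≠ c)
    (hbd : b ≠ d) (hcd : c ≠ d) (x : W → List Bool) :
    (add a b c d).Runs x
      (update (update (update (update x a []) b []) c
        ((addCarry false (x a) (x b)).reverse ++ x c)) d
        ((x b).reverse ++ x d)) ((x a).length + (x b).length + 1) :=
  add_runsFrom hab hac had hbc hbd hcd false _ _ x rfl rfl

/-- The first half of `pred`. -/
def predLoop (a b : W) : BitFrag W :=
  atom (Γ := fun _ : W => Bool) (σ := Reg) <| .pop a (fun _ o => (o, none, false)) <|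
    .branch (fun r => r.1.isNone) .halt <|
    .branch (fun r => r.1.getD false)
      (.peek a (fun r o => (r.1, o, false)) <|
        .branch (fun r => r.2.1.isNone) (.load (fun _ => default) .halt) <|
        .push a (fun _ => false) <| .load (fun _ => default) .halt)
      (.push b (fun _ => true) <| .load (fun _ => default) <| .goto fun _ => ())

/-- Trailing zeros become ones and pile up on `b` in reverse order until the first one is found and
cleared. The predecessor is then split between the two stacks: `m`, reversed, followed by `l`. -/
theorem predLoop_runs {a b : W} (hab : a ≠ b) (x : W → List Bool) :
    ∃ l m : List Bool, m.reverse ++ l = (x b).reverse ++ bitPred (x a) ∧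
      m.length ≤ (x a).length + (x b).length ∧
      (predLoop a b).Runs x (update (update x a l) b m) ((x a).length + 1) := by
  generalize h : x a = l
  induction l using bitPred.induct generalizing x with
  | case1 =>
    refine ⟨[], x b, by simp [bitPred], by simp, RunsFrom.congr (atom_exit (S' := x) ?_) ?_ le_rfl⟩
    · have h₁ : update x a [] = x := by rw [← h, update_eq_self]
      simp [TM2.stepAux, h, h₁]
      rfl
    · funext k
      simp [update_apply]
      grind
  | case2 l ih =>
    obtain ⟨l', m', h₁, h₂, h₃⟩ := ih (update (update x a l) b (true :: x b))
      (by simp [update_of_ne hab])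
    refine ⟨l', m', by simpa [bitPred] using h₁, ?_, ?_⟩
    · simp at h₂ ⊢; omega
    · refine atom_repeat (v' := default) (S' := update (update x a l) b (true :: x b)) ?_
        (RunsFrom.congr h₃ ?_ le_rfl)
      · simp [TM2.stepAux, h, update_of_ne hab.symm]
      · funext k
        simp [update_apply]
        grind
  | case3 =>
    refine ⟨[], x b, by simp [bitPred], by simp,
      RunsFrom.congr (atom_exit (S' := update x a []) ?_) ?_ (by simp)⟩
    · simp [TM2.stepAux, h]
    · funext k
      simp [update_apply]
      grind
  | case4 c l =>
    refine ⟨false :: c :: l, x b, by simp [bitPred], by simp,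
      RunsFrom.congr (atom_exit (S' := update x a (false :: c :: l)) ?_) ?_ (by simp)⟩
    · simp [TM2.stepAux, h]
    · funext k
      simp [update_apply]
      grind

/-- Replace the binary number on stack `a` by its predecessor, using the empty stack `b`. -/
def pred (a b : W) : BitFrag W := (predLoop a b).seq (move b a id)

theorem pred_runs {a b : W} (hab : a ≠ b) (x : W → List Bool) (hb : x b = []) :
    (pred a b).Runs x (update x a (bitPred (x a))) (2 * (x a).length + 2) := by
  obtain ⟨l, m, h₁, h₂, h₃⟩ := predLoop_runs hab x
  refine RunsFrom.congr (h₃.seq (move_runs hab.symm id _)) ?_ ?_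
  · funext k
    simp [update_apply]
    grind
  · simp [hb] at h₂ ⊢; omega

end BitFrag

/-! ## Binary numbers -/

/-- The value of a list of binary digits, least significant digit first. -/
def bitVal : List Bool → ℕ
  | [] => 0
  | b :: l => b.toNat + 2 * bitVal l

theorem bitVal_addCarry (c : Bool) (l m : List Bool) :
    bitVal (addCarry c l m) = c.toNat + bitVal l + bitVal m := by
  induction c, l, m using addCarry.induct with
  | case1 => simp [addCarry, bitVal]
  | case2 c hc => simp_all [addCarry, bitVal]
  | case3 c e l ih =>
    rw [addCarry]
    simp only [bitVal] at ih ⊢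
    rw [ih]
    cases c <;> cases e <;> simp
    ring
  | case4 c e l ih =>
    rw [addCarry]
    simp only [bitVal] at ih ⊢
    rw [ih]
    cases c <;> cases e <;> simp
    ring
  | case5 c e l f m ih =>
    rw [addCarry, bitVal, ih, bitVal, bitVal]
    cases c <;> cases e <;> cases f <;> simp <;> ring

theorem length_addCarry_le (c : Bool) (l m : List Bool) :
    (addCarry c l m).length ≤ max l.length m.length + 1 := by
  induction c, l, m using addCarry.induct with
  | case1 => simp [addCarry]
  | case2 c hc => simp_all [addCarry]
  | case3 c e l ih => simp_all [addCarry]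
  | case4 c e l ih => simp_all [addCarry]
  | case5 c e l f m ih =>
    rw [addCarry, List.length_cons, List.length_cons, List.length_cons]
    omega

theorem bitVal_replicate_false_append (s : ℕ) (l : List Bool) :
    bitVal (List.replicate s false ++ l) = 2 ^ s * bitVal l := by
  induction s with
  | zero => simp
  | succ s ih => simp [List.replicate_succ, bitVal, ih, pow_succ']; ring

theorem bitVal_lt (l : List Bool) : bitVal l < 2 ^ l.length := by
  induction l with
  | nil => simp [bitVal]
  | cons b l ih => cases b <;> simp [bitVal, pow_succ] <;> omega

theorem bitVal_drop (k : ℕ) (l : List Bool) : bitVal (l.drop k) = bitVal l / 2 ^ k := by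
  induction k generalizing l with
  | zero => simp
  | succ k ih =>
    cases l with
    | nil => simp [bitVal]
    | cons b l =>
      rw [List.drop_succ_cons, ih, pow_succ', ← Nat.div_div_eq_div_mul]
      congr 1
      cases b <;> simp [bitVal] ; omega

theorem bitVal_take (k : ℕ) (l : List Bool) : bitVal (l.take k) = bitVal l % 2 ^ k := by
  have h₁ : bitVal l = bitVal (l.take k) + 2 ^ k * bitVal (l.drop k) := by
    induction k generalizing l with
    | zero => simp [bitVal]
    | succ k ih =>
      cases l with
      | nil => simp [bitVal]
      | cons b l =>
        simp only [List.take_succ_cons, List.drop_succ_cons, bitVal]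
        rw [ih l]; ring
  rcases le_or_gt k l.length with h | h
  · have h₂ := bitVal_lt (l.take k)
    rw [List.length_take, min_eq_left h] at h₂
    rw [h₁, Nat.add_mul_mod_self_left, Nat.mod_eq_of_lt h₂]
  · rw [List.take_of_length_le h.le, Nat.mod_eq_of_lt]
    exact (bitVal_lt l).trans_le (Nat.pow_le_pow_right (by norm_num) h.le)

open Computability

theorem encodeNat_zero : encodeNat 0 = [] := rfl

theorem encodeNat_two_mul (n : ℕ) (hn : 0 < n) : encodeNat (2 * n) = false :: encodeNat n := by
  have h : ((2 * n : ℕ) : Num) = Num.bit0 (n : Num) := by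
    rw [← Num.bit0_of_bit0]; push_cast; ring
  unfold encodeNat
  rw [h]
  cases h' : (n : Num) with
  | zero =>
    rw [show Num.zero = ((0 : ℕ) : Num) from rfl, Num.of_nat_inj] at h'
    omega
  | pos p => rfl

theorem encodeNat_two_mul_add_one (n : ℕ) : encodeNat (2 * n + 1) = true :: encodeNat n := by
  have h : ((2 * n + 1 : ℕ) : Num) = Num.bit1 (n : Num) := by
    rw [← Num.bit1_of_bit1]; push_cast; ring
  unfold encodeNat
  rw [h]
  cases (n : Num) with
  | zero => rfl
  | pos p => rfl

theorem encodeNat_ne_nil {n : ℕ} (hn : 0 < n) : encodeNat n ≠ [] := by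
  intro h
  have := decode_encodeNat n
  rw [h] at this
  simp [decodeNat, decodeNum] at this
  omega

theorem bitVal_encodeNat (n : ℕ) : bitVal (encodeNat n) = n := by
  induction n using Nat.strong_induction_on with
  | _ n ih =>
    obtain ⟨m, rfl | rfl⟩ := n.even_or_odd'
    · rcases m.eq_zero_or_pos with rfl | hm
      · rfl
      · rw [encodeNat_two_mul m hm, bitVal, ih m (by omega)]; simp
    · rw [encodeNat_two_mul_add_one, bitVal, ih m (by omega)]; simp; omega

theorem two_pow_length_encodeNat_le {n : ℕ} (hn : 0 < n) :
    2 ^ (encodeNat n).length ≤ 2 * n := by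
  induction n using Nat.strong_induction_on with
  | _ n ih =>
    obtain ⟨m, rfl | rfl⟩ := n.even_or_odd'
    · rw [encodeNat_two_mul m (by omega), List.length_cons, pow_succ]
      have := ih m (by omega) (by omega)
      omega
    · rw [encodeNat_two_mul_add_one, List.length_cons, pow_succ]
      rcases m.eq_zero_or_pos with rfl | hm
      · simp [encodeNat_zero]
      · have := ih m (by omega) hm
        omega

theorem bitPred_encodeNat (n : ℕ) : bitPred (encodeNat (n + 1)) = encodeNat n := by
  induction n using Nat.strong_induction_on with
  | _ n ih =>
    obtain ⟨m, rfl | rfl⟩ := n.even_or_odd'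
    · rw [encodeNat_two_mul_add_one]
      rcases m.eq_zero_or_pos with rfl | hm
      · rfl
      · rw [encodeNat_two_mul m hm]
        cases h : encodeNat m with
        | nil => exact absurd h (encodeNat_ne_nil hm)
        | cons b l => rfl
    · rw [show 2 * m + 1 + 1 = 2 * (m + 1) by ring, encodeNat_two_mul _ m.succ_pos, bitPred,
        ih m (by omega), encodeNat_two_mul_add_one]

/-- Only leading zeros distinguish a digit list from the canonical code of its value; they come
first once the list is reversed. -/
theorem reverse_dropWhile_reverse (l : List Bool) :
    (l.reverse.dropWhile (!·)).reverse = encodeNat (bitVal l) := by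
  induction l with
  | nil => rfl
  | cons b l ih =>
    rw [List.reverse_cons, List.dropWhile_append]
    by_cases h : (l.reverse.dropWhile (!·)) = []
    · have h0 : encodeNat (bitVal l) = [] := by rw [← ih, h]; rfl
      have h1 : bitVal l = 0 := by
        by_contra h2
        exact encodeNat_ne_nil (Nat.pos_of_ne_zero h2) h0
      cases b <;> simp [h, bitVal, h1] <;> rfl
    · have h1 : 0 < bitVal l := by
        rw [Nat.pos_iff_ne_zero]
        intro h2
        rw [h2, encodeNat_zero, List.reverse_eq_nil_iff] at ih
        exact h ih
      rw [if_neg (by simpa using h), List.reverse_append, ih]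
      cases b
      · simp [bitVal, encodeNat_two_mul _ h1]
      · simp [bitVal, add_comm 1, encodeNat_two_mul_add_one]

/-! ## Calling a given machine -/

namespace Frag

open Function

section Mixed

variable {K₁ K₂ : Type} {Γ₁ : K₁ → Type} {Γ₂ : K₂ → Type} {σ Λ : Type}
  [DecidableEq K₁] [DecidableEq K₂]

theorem stepAux_pop_inr (k : K₂) (g : σ → Option (Γ₂ k) → σ)
    (q : TM2.Stmt (Sum.elim Γ₁ Γ₂) Λ σ) (v : σ) (y : ∀ k, List (Γ₁ k)) (x : ∀ k, List (Γ₂ k)) :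
    TM2.stepAux (.pop (.inr k) g q) v (joinStacks y x) =
      TM2.stepAux q (g v (x k).head?) (joinStacks y (update x k (x k).tail)) :=
  congrArg _ (update_joinStacks_inr ..)

theorem stepAux_pop_inl (k : K₁) (g : σ → Option (Γ₁ k) → σ)
    (q : TM2.Stmt (Sum.elim Γ₁ Γ₂) Λ σ) (v : σ) (y : ∀ k, List (Γ₁ k)) (x : ∀ k, List (Γ₂ k)) :
    TM2.stepAux (.pop (.inl k) g q) v (joinStacks y x) =
      TM2.stepAux q (g v (y k).head?) (joinStacks (update y k (y k).tail) x) :=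
  congrArg _ (update_joinStacks_inl ..)

theorem stepAux_push_inr (k : K₂) (g : σ → Γ₂ k)
    (q : TM2.Stmt (Sum.elim Γ₁ Γ₂) Λ σ) (v : σ) (y : ∀ k, List (Γ₁ k)) (x : ∀ k, List (Γ₂ k)) :
    TM2.stepAux (.push (.inr k) g q) v (joinStacks y x) =
      TM2.stepAux q v (joinStacks y (update x k (g v :: x k))) :=
  congrArg _ (update_joinStacks_inr ..)

theorem stepAux_push_inl (k : K₁) (g : σ → Γ₁ k)
    (q : TM2.Stmt (Sum.elim Γ₁ Γ₂) Λ σ) (v : σ) (y : ∀ k, List (Γ₁ k)) (x : ∀ k, List (Γ₂ k)) :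
    TM2.stepAux (.push (.inl k) g q) v (joinStacks y x) =
      TM2.stepAux q v (joinStacks (update y k (g v :: y k)) x) :=
  congrArg _ (update_joinStacks_inl ..)

theorem stepAux_branch_of_not {K : Type} [DecidableEq K] {Γ : K → Type} {p : σ → Bool}
    {q₁ q₂ : TM2.Stmt Γ Λ σ} {v : σ} {S : ∀ k, List (Γ k)} (h : p v = false) :
    TM2.stepAux (.branch p q₁ q₂) v S = TM2.stepAux q₂ v S := by
  simp [TM2.stepAux, h]

end Mixed

variable {K W : Type} {Γ : K → Type} {σ : Type}

/-- The stack alphabets of a machine with alphabets `Γ` and additional stacks of bits. -/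
abbrev WithBits (Γ : K → Type) (W : Type) : K ⊕ W → Type := Sum.elim Γ fun _ : W => Bool

/-- Move the contents of the bit stack `a` to the bit stack `c` and, encoded by `f`, to the
stack `k` of the given machine. -/
def send (a c : W) (k : K) (f : Bool → Γ k) : Frag (WithBits Γ W) (σ × Reg) :=
  atom <| .pop (.inr a) (fun v o => (v.1, (o, none, false))) <|
    .branch (fun v => v.2.1.isNone) .halt <|
    .push (.inr c) (fun v => v.2.1.getD false) <| .push (.inl k) (fun v => f (v.2.1.getD false)) <|
    .load (fun v => (v.1, default)) <| .goto fun _ => ()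

/-- Move the contents of the stack `k` of the given machine, decoded by `f`, to the bit
stack `a`. -/
def receive (k : K) (f : Γ k → Bool) (a : W) : Frag (WithBits Γ W) (σ × Reg) :=
  atom <| .pop (.inl k) (fun v o => (v.1, (o.map f, none, false))) <|
    .branch (fun v => v.2.1.isNone) .halt <|
    .push (.inr a) (fun v => v.2.1.getD false) <|
    .load (fun v => (v.1, default)) <| .goto fun _ => ()

variable [DecidableEq K] [DecidableEq W] [Inhabited σ]

theorem Runs.congr {F : Frag Γ σ} {x x' y y' : ∀ k, List (Γ k)} {t t' : ℕ}
    (h : F.Runs x y t) (e : x = x') (e' : y = y') (ht : t ≤ t') : F.Runs x' y' t' :=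
  e ▸ e' ▸ h.mono ht

theorem send_runs {a c : W} (hac : a ≠ c) {k : K} (f : Bool → Γ k) (y : ∀ k, List (Γ k))
    (x : W → List Bool) :
    (send (σ := σ) a c k f).Runs (joinStacks y x)
      (joinStacks (update y k ((x a).reverse.map f ++ y k))
        (update (update x a []) c ((x a).reverse ++ x c))) ((x a).length + 1) := by
  generalize h : x a = l
  induction l generalizing x y with
  | nil =>
    have e₁ : update x a [] = x := by rw [← h, update_eq_self]
    refine Runs.congr (atom_exit (v' := default) (S' := joinStacks y x) ?_) rfl ?_ (by simp)
    · refine (stepAux_pop_inr (Γ₁ := Γ) (Γ₂ := fun _ => Bool) a _ _ _ y x).trans ?_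
      rw [h]
      exact congrArg (fun x => (⟨none, default, joinStacks y x⟩ : TM2.Cfg _ Unit _)) e₁
    · simp [e₁]
  | cons d l ih =>
    refine atom_repeat (v' := default)
      (S' := joinStacks (update y k (f d :: y k)) (update (update x a l) c (d :: x c))) ?_
       (Runs.congr (ih _ _ ?_) rfl ?_ le_rfl)
    · refine (stepAux_pop_inr (Γ₁ := Γ) (Γ₂ := fun _ => Bool) a _ _ _ y x).trans ?_
      rw [h]
      refine (stepAux_branch_of_not rfl).trans ?_
      refine (stepAux_push_inr (Γ₁ := Γ) (Γ₂ := fun _ => Bool) c _ _ _ y _).trans <|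
        (stepAux_push_inl (Γ₁ := Γ) (Γ₂ := fun _ => Bool) k _ _ _ y _).trans ?_
      rw [update_of_ne hac.symm]
      rfl
    · simp [hac]
    · congr 1
      · simp
      · funext j
        simp [update_apply]
        grind

theorem receive_runs {k : K} (f : Γ k → Bool) (a : W) (y : ∀ k, List (Γ k))
    (x : W → List Bool) :
    (receive (σ := σ) k f a).Runs (joinStacks y x)
      (joinStacks (update y k []) (update x a ((y k).reverse.map f ++ x a)))
      ((y k).length + 1) := by
  generalize h : y k = l
  induction l generalizing x y with
  | nil =>
    have e₁ : update y k [] = y := by rw [← h, update_eq_self]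
    refine Runs.congr (atom_exit (v' := default) (S' := joinStacks y x) ?_) rfl ?_ (by simp)
    · refine (stepAux_pop_inl (Γ₁ := Γ) (Γ₂ := fun _ => Bool) k _ _ _ y x).trans ?_
      rw [h]
      exact congrArg (fun y => (⟨none, default, joinStacks y x⟩ : TM2.Cfg _ Unit _)) e₁
    · simp [e₁]
  | cons d l ih =>
    refine atom_repeat (v' := default)
      (S' := joinStacks (update y k l) (update x a (f d :: x a))) ?_
       (Runs.congr (ih _ _ ?_) rfl ?_ le_rfl)
    · refine (stepAux_pop_inl (Γ₁ := Γ) (Γ₂ := fun _ => Bool) k _ _ _ y x).trans ?_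
      rw [h]
      refine (stepAux_branch_of_not rfl).trans ?_
      exact stepAux_push_inr (Γ₁ := Γ) (Γ₂ := fun _ => Bool) a _ _ _ _ x
    · simp
    · congr 1
      · simp
      · simp

end Frag

/-- A machine as a fragment. -/
def Turing.FinTM2.toFrag (tm : FinTM2) : Frag tm.Γ tm.σ := ⟨tm.Λ, tm.ΛFin, tm.main, tm.m⟩

theorem Turing.initList_stk (tm : FinTM2) (l : List (tm.Γ tm.k₀)) :
    (initList tm l).stk = Function.update (fun _ => []) tm.k₀ l := by
  funext k
  by_cases h : k = tm.k₀
  · subst h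
    simp [initList]
  · simp [initList, h]

theorem Turing.haltList_stk (tm : FinTM2) (l : List (tm.Γ tm.k₁)) :
    (haltList tm l).stk = Function.update (fun _ => []) tm.k₁ l := by
  funext k
  by_cases h : k = tm.k₁
  · subst h
    simp [haltList]
  · simp [haltList, h]

/-- Running a machine as a fragment is the same as running it. -/
theorem Turing.FinTM2.toFrag_runs_iff (tm : FinTM2) (l : List (tm.Γ tm.k₀))
    (l' : List (tm.Γ tm.k₁)) (t : ℕ) :
    tm.toFrag.Runs (Function.update (fun _ => []) tm.k₀ l) (Function.update (fun _ => []) tm.k₁ l')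
      t ↔ Nonempty (TM2OutputsInTime tm l (some l') t) := by
  rw [← initList_stk, ← haltList_stk]
  constructor
  · rintro ⟨n, hn, h⟩
    exact ⟨⟨⟨n, StepsTo.iff_iterate.mp h⟩, hn⟩⟩
  · rintro ⟨⟨⟨n, h⟩, hn⟩⟩
    exact ⟨n, hn, StepsTo.iff_iterate.mpr h⟩

namespace Frag

open Function

variable {W : Type}

/-- Run the machine `M` on the binary number on stack `c`, and put its output on the empty
stack `a`, in reverse order. -/
def call (M : TM2ComputableAux Bool Bool) (c a : W) :
    Frag (WithBits M.tm.Γ W) (M.tm.σ × Reg) :=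
  (BitFrag.move c a id).right.seq <| (send a c M.tm.k₀ M.inputAlphabet.symm).seq <|
    M.tm.toFrag.left.seq <| receive M.tm.k₁ M.outputAlphabet a

variable [DecidableEq W]

/-- The argument on `c` survives: it is moved to `a` and back, being copied to the input stack on
the way. Afterwards the stacks of `M` are empty again, so the call can be repeated. -/
theorem call_runs {M : TM2ComputableAux Bool Bool} {c a : W} (hca : c ≠ a) {l' : List Bool} {t : ℕ}
    (x : W → List Bool) (ha : x a = [])
    (hM : Nonempty (TM2OutputsInTime M.tm ((x c).map M.inputAlphabet.symm)
      (some (l'.map M.outputAlphabet.symm)) t)) :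
    (call M c a).Runs (joinStacks (fun _ => []) x)
      (joinStacks (fun _ => []) (update x a l'.reverse))
      (t + 2 * (x c).length + l'.length + 3) := by
  set x₁ := update (update x c []) a (x c).reverse with hx₁
  set y₁ : ∀ k, List (M.tm.Γ k) := update (fun _ => []) M.tm.k₀ ((x c).map M.inputAlphabet.symm)
  set y₂ : ∀ k, List (M.tm.Γ k) := update (fun _ => []) M.tm.k₁ (l'.map M.outputAlphabet.symm)
  have hx : update (update x₁ a []) c ((x₁ a).reverse ++ x₁ c) = x := by
    funext k
    simp [hx₁, update_apply]
    grind
  have h₁ : (BitFrag.move c a id).Runs x x₁ ((x c).length + 1) :=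
    Runs.congr (BitFrag.move_runs hca id x) rfl (by simp [x₁, ha]) le_rfl
  have h₂ : (send (σ := M.tm.σ) a c M.tm.k₀ M.inputAlphabet.symm).Runs
      (joinStacks (fun _ => []) x₁) (joinStacks y₁ x) ((x c).length + 1) :=
    Runs.congr (send_runs hca.symm _ _ _) rfl (by rw [hx]; simp [y₁, hx₁]) (by simp [hx₁])
  have h₃ := ((M.tm.toFrag_runs_iff _ _ _).mpr hM).left (σ₂ := Reg) x
  have h₄ : (receive (σ := M.tm.σ) M.tm.k₁ M.outputAlphabet a).Runs (joinStacks y₂ x)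
      (joinStacks (fun _ => []) (update x a l'.reverse)) (l'.length + 1) :=
    Runs.congr (receive_runs _ _ _ _) rfl (by simp [y₂, ha]) (by simp [y₂])
  exact ((h₁.right _).seq (h₂.seq (h₃.seq h₄))).mono (by omega)

end Frag

/-! ## The program -/

/-- The names of the stacks of bits of the program. -/
inductive Work
  | cnt | cnt' | un | un' | width | shift | acc | arr | tmp | tmp'
deriving DecidableEq

instance : Fintype Work where
  elems := {.cnt, .cnt', .un, .un', .width, .shift, .acc, .arr, .tmp, .tmp'}
  complete x := by cases x <;> decide

/-- The contents of the stacks of bits of the program. -/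
structure Store where
  /-- a binary counter -/
  cnt : List Bool := []
  /-- a second binary counter -/
  cnt' : List Bool := []
  /-- a unary number -/
  un : List Bool := []
  /-- a second unary number -/
  un' : List Bool := []
  /-- the width of the entries of the array, in unary -/
  width : List Bool := []
  /-- an offset in the array, in unary -/
  shift : List Bool := []
  /-- an accumulator containing an array -/
  acc : List Bool := []
  /-- an array -/
  arr : List Bool := []
  /-- auxiliary storage -/
  tmp : List Bool := []
  /-- more auxiliary storage -/
  tmp' : List Bool := []

namespace Store

/-- The stacks of a store. -/
def stk (x : Store) : Work → List Bool
  | .cnt => x.cnt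
  | .cnt' => x.cnt'
  | .un => x.un
  | .un' => x.un'
  | .width => x.width
  | .shift => x.shift
  | .acc => x.acc
  | .arr => x.arr
  | .tmp => x.tmp
  | .tmp' => x.tmp'

/-- Replace one stack of a store. -/
def set (x : Store) (l : List Bool) : Work → Store
  | .cnt => { x with cnt := l }
  | .cnt' => { x with cnt' := l }
  | .un => { x with un := l }
  | .un' => { x with un' := l }
  | .width => { x with width := l }
  | .shift => { x with shift := l }
  | .acc => { x with acc := l }
  | .arr => { x with arr := l }
  | .tmp => { x with tmp := l }
  | .tmp' => { x with tmp' := l }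

theorem update_stk (x : Store) (w : Work) (l : List Bool) :
    Function.update x.stk w l = (x.set l w).stk := by
  funext k
  cases w <;> cases k <;> rfl

end Store

namespace BitFrag

open Work Frag

/-- Unary numbers. -/
abbrev marks (n : ℕ) : List Bool := List.replicate n true

/-- The test of a loop which counts a unary number on `a` down, and one on `b` up. -/
def tick {W : Type} (a b : W) : TM2.Stmt (fun _ : W => Bool) Unit Reg :=
  .pop a (fun _ o => (o, none, false)) <| .branch (fun r => r.1.isNone) .halt <|
    .push b (fun _ => true) <| .load (fun _ => default) <| .goto fun _ => ()

theorem tick_loop_runs {F : BitFrag Work} {n t : ℕ} (A : ℕ → Store)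
    (hF : ∀ i < n, F.Runs { A i with un := marks (n - (i + 1)), un' := marks (i + 1) }.stk
      { A (i + 1) with un := marks (n - (i + 1)), un' := marks (i + 1) }.stk t) :
    (loop (tick un un') F).Runs { A 0 with un := marks n, un' := [] }.stk
      { A n with un := [], un' := marks n }.stk (n * (t + 1) + 1) := by
  refine Runs.loop n (fun i => { A i with un := marks (n - i), un' := marks i }.stk)
    (fun i => { A i with un := marks (n - (i + 1)), un' := marks (i + 1) }.stk) ?_ hF ?_
  · intro i hi
    have : n - i = (n - (i + 1)) + 1 := by omega
    simp [tick, TM2.stepAux, Store.update_stk, Store.stk, Store.set, this, List.replicate_succ]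
  · simp [tick, TM2.stepAux, Store.update_stk, Store.stk, Store.set]
    rfl

/-- Multiply the array in the accumulator by a power of `2`. -/
def shiftAcc : BitFrag Work :=
  (moveTwo .shift tmp acc (fun _ => true) (fun _ => false)).seq (move tmp .shift id)

theorem shiftAcc_runs (x : Store) (s : ℕ) (hs : x.shift = marks s) (ht : x.tmp = []) :
    shiftAcc.Runs x.stk { x with acc := List.replicate s false ++ x.acc }.stk (2 * s + 2) := by
  obtain ⟨⟩ := x
  dsimp only at hs ht
  subst hs ht
  refine Runs.congr ((moveTwo_runs (by decide) (by decide) (by decide) _ _ _).seq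
    (move_runs (by decide) _ _)) rfl ?_ ?_
  · simp [Store.update_stk, Store.stk, Store.set]
  · simp [Store.update_stk, Store.stk, Store.set]; omega

/-- Add the array to the accumulator. -/
def addAcc : BitFrag Work :=
  (add acc arr tmp tmp').seq <| (move tmp acc id).seq (move tmp' arr id)

theorem addAcc_runs (x : Store) (ht : x.tmp = []) (ht' : x.tmp' = []) :
    addAcc.Runs x.stk { x with acc := addCarry false x.acc x.arr }.stk
      (2 * x.acc.length + 3 * x.arr.length + 4) := by
  obtain ⟨cnt, cnt', un, un', width, shift, acc, arr, tmp, tmp'⟩ := x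
  dsimp only at ht ht'
  subst ht ht'
  refine Runs.congr ((add_runs (by decide) (by decide) (by decide) (by decide) (by decide)
    (by decide) _).seq <| (move_runs (by decide) _ _).seq (move_runs (by decide) _ _)) rfl ?_ ?_
  · simp [Store.update_stk, Store.stk, Store.set]
  · simp only [Store.update_stk, Store.stk, Store.set, List.length_append, List.length_reverse,
      List.length_nil]
    have := length_addCarry_le false acc arr
    omega

/-- Multiply the array `v` by `2 ^ s` and add the array `l`. -/
def hornerStep (s : ℕ) (l v : List Bool) : List Bool :=
  addCarry false (List.replicate s false ++ v) l

theorem length_hornerStep_le (s : ℕ) (l v : List Bool) :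
    (hornerStep s l v).length ≤ max (s + v.length) l.length + 1 := by
  simpa [hornerStep] using length_addCarry_le false (List.replicate s false ++ v) l

/-- Let the array consist of the number stored (reversed and signed) in `tmp`, shifted, plus the
old array, and copy it to the accumulator. -/
def loadArr : BitFrag Work :=
  ((move tmp acc id).seq (drop acc)).seq <| shiftAcc.seq <| addAcc.seq <| (clear arr).seq <|
    (move acc tmp id).seq <| moveTwo tmp acc arr id id

theorem loadArr_runs (x : Store) (s : ℕ) (c : Bool) (l : List Bool) (hs : x.shift = marks s)
    (ht : x.tmp = (c :: l).reverse) (ht' : x.tmp' = []) (ha : x.acc = []) :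
    loadArr.Runs x.stk
      { x with acc := hornerStep s x.arr l, arr := hornerStep s x.arr l, tmp := [] }.stk
      (8 * (s + l.length + x.arr.length) + 20) := by
  obtain ⟨cnt, cnt', un, un', width, shift, acc, arr, tmp, tmp'⟩ := x
  dsimp only at hs ht ht' ha
  subst hs ht ht' ha
  -- The code arrives reversed, with the sign bit at the bottom; moving it to `acc` brings the sign
  -- bit to the top, where it is dropped.
  have h₁ := (move_runs (show Work.tmp ≠ Work.acc by decide) id _).seq
    (drop_runs Work.acc _) |>.congr (x' := Store.stk ⟨cnt, cnt', un, un', width, marks s, [], arr,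
      (c :: l).reverse, []⟩) (y' := Store.stk ⟨cnt, cnt', un, un', width, marks s, l, arr,
      [], []⟩) (t' := l.length + 3) rfl ?_ ?_
  · refine (h₁.seq <| (shiftAcc_runs _ s rfl rfl).seq <| (addAcc_runs _ rfl rfl).seq <|
      (clear_runs _ _).seq <| (move_runs (by decide) _ _).seq
      (moveTwo_runs (by decide) (by decide) (by decide) _ _ _)).congr rfl ?_ ?_
    · simp [Store.update_stk, Store.stk, Store.set, hornerStep]
    · have := length_hornerStep_le s arr l
      unfold hornerStep at this
      simp [Store.update_stk, Store.stk, Store.set]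
      omega
  · simp [Store.update_stk, Store.stk, Store.set]
  · simp [Store.stk]

/-- Repeatedly apply `hornerStep` to the accumulator. -/
def horner : BitFrag Work :=
  (loop (tick un un') (shiftAcc.seq addAcc)).seq (move un' un id)

/-- Iterating v ↦ 2^s v + l from v = l multiplies l by the truncated geometric series in 2^s. The
bound `L` on all intermediate lengths makes every round cost the same. -/
theorem horner_runs (x : Store) (s n L : ℕ) (hs : x.shift = marks s) (hn : x.un = marks n)
    (hn' : x.un' = []) (ht : x.tmp = []) (ht' : x.tmp' = [])
    (hL : ∀ i < n, s + ((hornerStep s x.arr)^[i] x.acc).length ≤ L) (hL' : x.arr.length ≤ L) :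
    horner.Runs x.stk { x with acc := (hornerStep s x.arr)^[n] x.acc }.stk
      (n * (7 * L + 6 + 1) + n + 2) := by
  obtain ⟨cnt, cnt', un, un', width, shift, acc, arr, tmp, tmp'⟩ := x
  dsimp only at hs hn hn' ht ht' hL hL'
  subst hs hn hn' ht ht'
  refine ((tick_loop_runs (n := n) (t := 7 * L + 6) (fun i => ⟨cnt, cnt', [], [], width, marks s,
    (hornerStep s arr)^[i] acc, arr, [], []⟩) ?_).seq (move_runs (by decide) _ _)).congr rfl ?_ ?_
  · intro i hi
    refine ((shiftAcc_runs _ s rfl rfl).seq (addAcc_runs _ rfl rfl)).congr rfl ?_ ?_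
    · rw [Function.iterate_succ_apply']
      rfl
    · have := hL i hi
      simp
      omega
  · simp [Store.update_stk, Store.stk, Store.set]
  · simp [Store.stk]
    omega

/-- Move the accumulator to the array, subtract the width from the offset, and decrease the
counter. -/
def storeArr : BitFrag Work :=
  (clear arr).seq <| (move acc tmp id).seq <| (move tmp arr id).seq <|
    (moveDrop width tmp Work.shift).seq <| (move tmp width id).seq <| pred cnt tmp

theorem storeArr_runs (x : Store) (B s : ℕ) (hB : x.width = marks B)
    (hs : x.shift = marks (B + s)) (ht : x.tmp = []) :
    storeArr.Runs x.stk { x with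
        acc := [], arr := x.acc, cnt := bitPred x.cnt, shift := marks s }.stk
      (2 * (x.arr.length + x.acc.length + B + x.cnt.length) + 7) := by
  obtain ⟨cnt, cnt', un, un', width, shift, acc, arr, tmp, tmp'⟩ := x
  dsimp only at hB hs ht
  subst hB hs ht
  refine ((clear_runs _ _).seq <| (move_runs (by decide) _ _).seq <|
    (move_runs (by decide) _ _).seq <|
    (moveDrop_runs (by decide) (by decide) (by decide) _).seq <|
    (move_runs (by decide) _ _).seq <| pred_runs (by decide) _ ?_).congr rfl ?_ ?_
  · simp [Store.update_stk, Store.stk, Store.set]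
  · simp [Store.update_stk, Store.stk, Store.set]
  · simp [Store.update_stk, Store.stk, Store.set]
    omega

/-- Replace the array `l` by a new one, using the number with binary digits `d`. -/
def nextArr (n s : ℕ) (d l : List Bool) : List Bool :=
  (hornerStep s (hornerStep s l d))^[n] (hornerStep s l d)

/-- Compute `nextArr`. -/
def stepArr : BitFrag Work := loadArr.seq <| horner.seq storeArr

theorem stepArr_runs (x : Store) (B s n L : ℕ) (c : Bool) (l : List Bool) (hB : x.width = marks B)
    (hs : x.shift = marks (B + s)) (hn : x.un = marks n) (hn' : x.un' = [])
    (ht : x.tmp = (c :: l).reverse) (ht' : x.tmp' = []) (ha : x.acc = [])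
    (hL : ∀ i ≤ n, B + s + ((hornerStep (B + s) (hornerStep (B + s) x.arr l))^[i]
      (hornerStep (B + s) x.arr l)).length ≤ L)
    (hl : l.length ≤ L) (harr : x.arr.length ≤ L) (hcnt : x.cnt.length ≤ L) :
    stepArr.Runs x.stk { x with
        cnt := bitPred x.cnt, shift := marks s, tmp := [], arr := nextArr n (B + s) l x.arr }.stk
      (n * (7 * L + 6 + 1) + n + 32 * L + 29) := by
  have h₀ := hL 0 (Nat.zero_le _)
  have h₁ := hL n le_rfl
  simp only [Function.iterate_zero, id_eq] at h₀
  refine ((loadArr_runs x (B + s) c l hs ht ht' ha).seq <|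
    (horner_runs { x with
      acc := hornerStep (B + s) x.arr l, arr := hornerStep (B + s) x.arr l, tmp := [] }
      (B + s) n L hs hn hn' rfl ht' (fun i hi => hL i hi.le) (by dsimp only; omega)).seq <|
    storeArr_runs _ B s hB hs rfl).congr rfl ?_ ?_
  · simp [nextArr, ha]
  · simp only
    omega

/-- Let the offset be the product of `un` and the width. -/
def initShift : BitFrag Work :=
  (loop (tick un un') <| (moveTwo width tmp .shift id id).seq (move tmp width id)).seq
    (move un' un id)

theorem initShift_runs (x : Store) (B n : ℕ) (hB : x.width = marks B) (hn : x.un = marks n)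
    (hn' : x.un' = []) (ht : x.tmp = []) (hs : x.shift = []) :
    initShift.Runs x.stk { x with shift := marks (B * n) }.stk (n * (2 * B + 2 + 1) + n + 2) := by
  obtain ⟨cnt, cnt', un, un', width, shift, acc, arr, tmp, tmp'⟩ := x
  dsimp only at hB hn hn' ht hs
  subst hB hn hn' ht hs
  refine ((tick_loop_runs (n := n) (t := 2 * B + 2) (fun i => ⟨cnt, cnt', [], [], marks B,
    marks (B * i), acc, arr, [], tmp'⟩) ?_).seq (move_runs (by decide) _ _)).congr ?_ ?_ ?_
  · intro i hi
    refine ((moveTwo_runs (by decide) (by decide) (by decide) _ _ _).seq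
      (move_runs (by decide) _ _)).congr rfl ?_ ?_
    · simp [Store.update_stk, Store.stk, Store.set, Nat.mul_succ, Nat.add_comm]
    · simp [Store.update_stk, Store.stk, Store.set]
      omega
  · simp
  · simp [Store.update_stk, Store.stk, Store.set]
  · simp [Store.stk]
    omega

/-- Put the entry with index `un` of the array, with a sign, on the counter. -/
def extract : BitFrag Work :=
  (loop (tick un un') <| (moveDrop width tmp arr).seq (move tmp width id)).seq <|
    (clear un').seq <| (moveUpTo width arr tmp).seq <| (clear arr).seq <| (trim tmp).seq <|
    (move tmp cnt id).seq <| put cnt false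

/-- Dropping `B` bits `n` times divides by 2^(Bn), and keeping the next `B` bits reduces modulo 2^B.
These bits lie on `tmp` with the most significant one on top, so `trim` removes exactly the leading
zeros. -/
theorem extract_runs (B n : ℕ) (l : List Bool) :
    extract.Runs (Store.stk { un := marks n, width := marks B, arr := l })
      (Store.stk { cnt := false :: Computability.encodeNat (bitVal l / 2 ^ (B * n) % 2 ^ B) })
      (n * (2 * B + 2 + 1) + n + B + 3 * l.length + 7) := by
  refine ((tick_loop_runs (n := n) (t := 2 * B + 2) (fun i =>
    { width := marks B, arr := l.drop (B * i) }) ?_).seq <| (clear_runs _ _).seq <|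
    (moveUpTo_runs (by decide) (by decide) (by decide) _).seq <| (clear_runs _ _).seq <|
    (trim_runs _ _).seq <| (move_runs (by decide) _ _).seq <| put_runs _ _ _).congr ?_ ?_ ?_
  · intro i hi
    refine ((moveDrop_runs (by decide) (by decide) (by decide) _).seq
      (move_runs (by decide) _ _)).congr rfl ?_ ?_
    · simp [Store.update_stk, Store.stk, Store.set, Nat.mul_succ]
    · simp [Store.update_stk, Store.stk, Store.set]
      omega
  · simp
  · simp [Store.update_stk, Store.stk, Store.set]
    rw [reverse_dropWhile_reverse, bitVal_take, bitVal_drop]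
  · simp [Store.update_stk, Store.stk, Store.set]
    have := (List.dropWhile_suffix (fun b => !b) (l := (List.take B (List.drop (B * n) l)).reverse)).length_le
    simp at this
    omega

end BitFrag

namespace BitFrag

open Work Frag

/-- The test of a loop which runs as long as the stack `a` is not empty. -/
def nonempty {W : Type} (a : W) : TM2.Stmt (fun _ : W => Bool) Unit Reg :=
  .peek a (fun _ o => (o, none, false)) <| .branch (fun r => r.1.isNone) .halt <|
    .load (fun _ => default) <| .goto fun _ => ()

/-- Duplicate the counter. -/
def copyCnt : BitFrag Work := (move cnt tmp id).seq (moveTwo tmp cnt cnt' id id)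

theorem copyCnt_runs (l : List Bool) :
    copyCnt.Runs (Store.stk { cnt := l }) (Store.stk { cnt := l, cnt' := l })
      (2 * l.length + 2) := by
  refine ((move_runs (by decide) _ _).seq
    (moveTwo_runs (by decide) (by decide) (by decide) _ _ _)).congr rfl ?_ ?_
  · simp [Store.update_stk, Store.stk, Store.set]
  · simp [Store.update_stk, Store.stk, Store.set]
    omega

/-- Increase the width by the length of `tmp`, increase `un` and decrease the second counter. -/
def count : BitFrag Work :=
  (move tmp width fun _ => true).seq <| (put un true).seq (pred cnt' tmp)

theorem count_runs (c c' l : List Bool) (n B : ℕ) :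
    count.Runs (Store.stk { cnt := c, cnt' := c', un := marks n, width := marks B, tmp := l })
      (Store.stk {
          cnt := c, cnt' := bitPred c', un := marks (n + 1),
          width := marks (B + l.length) })
      (l.length + 2 * c'.length + 4) := by
  refine ((move_runs (by decide) _ _).seq <| (put_runs _ _ _).seq <|
    pred_runs (by decide) _ ?_).congr rfl ?_ ?_
  · simp [Store.update_stk, Store.stk, Store.set]
  · simp [Store.update_stk, Store.stk, Store.set, List.replicate_succ, add_comm B]
  · simp [Store.update_stk, Store.stk, Store.set]
    omega

end BitFrag

/-! ### The complete program and its running time -/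

section Program

open Work Frag BitFrag Computability

variable (M : TM2ComputableAux Bool Bool)

/-- Compute the width, and the input in unary. -/
def countLoop : Frag (WithBits M.tm.Γ Work) (M.tm.σ × Reg) :=
  loop (liftRight (nonempty cnt')) ((call M cnt' tmp).seq count.right)

/-- Compute the array. -/
def arrLoop : Frag (WithBits M.tm.Γ Work) (M.tm.σ × Reg) :=
  loop (liftRight (nonempty cnt)) ((call M cnt tmp).seq stepArr.right)

/-- The program for sums over partitions, given a machine `M` for the summands. -/
def partitionProgram : Frag (WithBits M.tm.Γ Work) (M.tm.σ × Reg) :=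
  copyCnt.right.seq <| (countLoop M).seq <| initShift.right.seq <| (arrLoop M).seq extract.right

/-- The stacks of the given machine, empty, together with the stacks of bits. -/
def Store.full (x : Store) : ∀ k, List (WithBits M.tm.Γ Work k) :=
  joinStacks (fun _ => []) x.stk

variable {M}

theorem BitFrag.nonempty_exit {a : Work} {x : Store} (h : x.stk a = []) :
    TM2.stepAux (liftRight (nonempty a)) (default : M.tm.σ × Reg) (x.full M) =
      ⟨none, default, x.full M⟩ := by
  refine (stepAux_liftRight ..).trans ?_
  simp [nonempty, TM2.stepAux, h]
  rfl

theorem BitFrag.nonempty_enter {a : Work} {x : Store} (h : x.stk a ≠ []) :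
    TM2.stepAux (liftRight (nonempty a)) (default : M.tm.σ × Reg) (x.full M) =
      ⟨some (), default, x.full M⟩ := by
  obtain ⟨b, l, h⟩ := List.exists_cons_of_ne_nil h
  refine (stepAux_liftRight ..).trans ?_
  simp [nonempty, TM2.stepAux, h]
  rfl

theorem Frag.Runs.loop_nonempty {F : Frag (WithBits M.tm.Γ Work) (M.tm.σ × Reg)} {a : Work}
    (n t : ℕ) (A : ℕ → Store) (hA : ∀ i < n, (A i).stk a ≠ []) (hn : (A n).stk a = [])
    (hF : ∀ i < n, F.Runs ((A i).full M) ((A (i + 1)).full M) t) :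
    (Frag.loop (liftRight (nonempty a)) F).Runs ((A 0).full M) ((A n).full M) (n * (t + 1) + 1) :=
  Runs.loop n (fun i => (A i).full M) (fun i => (A i).full M)
    (fun i hi => nonempty_enter (hA i hi)) hF (nonempty_exit hn)

/-- The width of the entries of the array after `i` rounds. -/
def widthAt (n : ℕ) (d : ℕ → List Bool) (i : ℕ) : ℕ :=
  ∑ k ∈ Finset.range i, ((d (n - k)).length + 1)

/-- The array after `i` rounds. -/
def arrAt (n B : ℕ) (d : ℕ → List Bool) : ℕ → List Bool
  | 0 => []
  | i + 1 => nextArr n (B * (n - i)) (d (n - i)) (arrAt n B d i)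

variable {n T L : ℕ} {d : ℕ → List Bool}

/-- The width of an entry must be known before the array is built, hence a separate pass over j = n,
..., 1. The same pass converts n to unary. -/
theorem countLoop_runs
    (hM : ∀ j, 1 ≤ j → j ≤ n → Nonempty (TM2OutputsInTime M.tm
      ((encodeNat j).map M.inputAlphabet.symm)
      (some ((false :: d j).map M.outputAlphabet.symm)) T))
    (hd : ∀ j, 1 ≤ j → j ≤ n → (d j).length + 1 ≤ L)
    (hL : ∀ j ≤ n, (encodeNat j).length ≤ L) :
    (countLoop M).Runs (Store.full M { cnt := encodeNat n, cnt' := encodeNat n })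
      (Store.full M { cnt := encodeNat n, un := marks n, width := marks (widthAt n d n) })
      (n * (T + 6 * L + 7 + 1) + 1) := by
  refine (Runs.loop_nonempty n (T + 6 * L + 7) (fun i =>
    { cnt := encodeNat n, cnt' := encodeNat (n - i), un := marks i,
      width := marks (widthAt n d i) }) ?_ ?_ ?_).congr ?_ ?_ le_rfl
  · exact fun i hi => encodeNat_ne_nil (by omega)
  · simp [Store.stk, encodeNat_zero]
  · intro i hi
    have h₁ := call_runs (M := M) (c := cnt') (a := tmp) (by decide) (l' := false :: d (n - i))
      (Store.stk {
          cnt := encodeNat n, cnt' := encodeNat (n - i), un := marks i,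
          width := marks (widthAt n d i) }) rfl (hM (n - i) (by omega) (by omega))
    have h₂ := (count_runs (encodeNat n) (encodeNat (n - i)) (false :: d (n - i)).reverse i
      (widthAt n d i)).right (σ₁ := M.tm.σ) (fun k => ([] : List (M.tm.Γ k)))
    rw [Store.update_stk] at h₁
    refine (h₁.seq h₂).congr rfl ?_ ?_
    · have e : n - i = n - (i + 1) + 1 := by omega
      simp only [Store.full]
      congr 2
      simp only [widthAt, Finset.sum_range_succ]
      rw [← bitPred_encodeNat (n - (i + 1)), ← e]
      simp
    · have := hd (n - i) (by omega) (by omega)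
      have := hL (n - i) (by omega)
      simp [Store.stk]
      omega
  · simp [widthAt]
  · simp [encodeNat_zero]

/-- Before round `i` the counter holds j = n - i and the offset is Bj, so a shift by the offset is
multiplication by x^j at x = 2^B. -/
theorem arrLoop_runs {B : ℕ}
    (hM : ∀ j, 1 ≤ j → j ≤ n → Nonempty (TM2OutputsInTime M.tm
      ((encodeNat j).map M.inputAlphabet.symm)
      (some ((false :: d j).map M.outputAlphabet.symm)) T))
    (hd : ∀ j, 1 ≤ j → j ≤ n → (d j).length + 1 ≤ L)
    (hL : ∀ j ≤ n, (encodeNat j).length ≤ L)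
    (harr : ∀ i < n, (arrAt n B d i).length ≤ L)
    (hacc : ∀ i < n, ∀ k ≤ n, B * (n - i) +
      ((hornerStep (B * (n - i)) (hornerStep (B * (n - i)) (arrAt n B d i) (d (n - i))))^[k]
        (hornerStep (B * (n - i)) (arrAt n B d i) (d (n - i)))).length ≤ L) :
    (arrLoop M).Runs (Store.full M
        { cnt := encodeNat n, un := marks n, width := marks B, shift := marks (B * n) })
      (Store.full M { un := marks n, width := marks B, arr := arrAt n B d n })
      (n * (T + 35 * L + 32 + (n * (7 * L + 6 + 1) + n) + 1) + 1) := by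
  refine (Runs.loop_nonempty n (T + 35 * L + 32 + (n * (7 * L + 6 + 1) + n)) (fun i =>
    { cnt := encodeNat (n - i), un := marks n, width := marks B, shift := marks (B * (n - i)),
      arr := arrAt n B d i }) ?_ ?_ ?_).congr ?_ ?_ le_rfl
  · exact fun i hi => encodeNat_ne_nil (by omega)
  · simp [Store.stk, encodeNat_zero]
  · intro i hi
    have e : B * (n - i) = B + B * (n - (i + 1)) := by
      rw [show n - i = n - (i + 1) + 1 by omega]; ring
    have h₁ := call_runs (M := M) (c := cnt) (a := tmp) (by decide) (l' := false :: d (n - i))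
      (Store.stk {
          cnt := encodeNat (n - i), un := marks n, width := marks B,
          shift := marks (B * (n - i)), arr := arrAt n B d i }) rfl
      (hM (n - i) (by omega) (by omega))
    rw [Store.update_stk] at h₁
    have h₃ := hd (n - i) (by omega) (by omega)
    have h₄ := hL (n - i) (by omega)
    have h₂ := (stepArr_runs (Store.set {
        cnt := encodeNat (n - i), un := marks n, width := marks B,
        shift := marks (B * (n - i)), arr := arrAt n B d i }
      (false :: d (n - i)).reverse tmp) B (B * (n - (i + 1))) n L false (d (n - i)) rfl
      (by rw [← e]; rfl) rfl rfl rfl rfl rfl (by rw [← e]; exact hacc i hi) (by omega)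
      (harr i hi) h₄).right (σ₁ := M.tm.σ) (fun k => ([] : List (M.tm.Γ k)))
    refine (h₁.seq h₂).congr rfl ?_ ?_
    · simp only [Store.full, arrAt]
      congr 2
      rw [← bitPred_encodeNat (n - (i + 1)), ← e]
      simp [Store.set, show n - (i + 1) + 1 = n - i by omega]
    · simp [Store.stk]
      omega
  · simp [arrAt]
  · simp [encodeNat_zero]

theorem partitionProgram_runs {B : ℕ} (hB : B = widthAt n d n)
    (hM : ∀ j, 1 ≤ j → j ≤ n → Nonempty (TM2OutputsInTime M.tm
      ((encodeNat j).map M.inputAlphabet.symm)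
      (some ((false :: d j).map M.outputAlphabet.symm)) T))
    (hd : ∀ j, 1 ≤ j → j ≤ n → (d j).length + 1 ≤ L)
    (hL : ∀ j ≤ n, (encodeNat j).length ≤ L) (hBL : B ≤ L)
    (harr : ∀ i ≤ n, (arrAt n B d i).length ≤ L)
    (hacc : ∀ i < n, ∀ k ≤ n, B * (n - i) +
      ((hornerStep (B * (n - i)) (hornerStep (B * (n - i)) (arrAt n B d i) (d (n - i))))^[k]
        (hornerStep (B * (n - i)) (arrAt n B d i) (d (n - i)))).length ≤ L) :
    (partitionProgram M).Runs (Store.full M { cnt := encodeNat n })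
      (Store.full M
        { cnt := false :: encodeNat (bitVal (arrAt n B d n) / 2 ^ (B * n) % 2 ^ B) })
      (100 * (n + 1) * (T + (n + 1) * (L + 1))) := by
  have h₁ := (copyCnt_runs (encodeNat n)).right (σ₁ := M.tm.σ) (fun k => ([] : List (M.tm.Γ k)))
  have h₂ := countLoop_runs hM hd hL
  rw [← hB] at h₂
  have h₃ := (initShift_runs { cnt := encodeNat n, un := marks n, width := marks B } B n rfl rfl rfl
    rfl rfl).right (σ₁ := M.tm.σ) (fun k => ([] : List (M.tm.Γ k)))
  have h₄ := arrLoop_runs hM hd hL (fun i hi => harr i hi.le) hacc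
  have h₅ := (extract_runs B n (arrAt n B d n)).right (σ₁ := M.tm.σ)
    (fun k => ([] : List (M.tm.Γ k)))
  refine (h₁.seq (h₂.seq (h₃.seq (h₄.seq h₅)))).mono ?_
  have h₆ := hL n le_rfl
  have h₇ := harr n le_rfl
  have h₈ : n * B ≤ n * L := Nat.mul_le_mul_left n hBL
  nlinarith [Nat.zero_le (n * T), Nat.zero_le (n * L), Nat.zero_le (n * n * L)]

end Program

/-! ### Length and value of the array, and reading off a coefficient -/

namespace BitFrag

theorem length_iterate_hornerStep_le (s k : ℕ) (l : List Bool) :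
    ((hornerStep s l)^[k] l).length ≤ l.length + k * (s + 1) := by
  induction k with
  | zero => simp
  | succ k ih =>
    rw [Function.iterate_succ_apply', Nat.succ_mul]
    have := length_hornerStep_le s l ((hornerStep s l)^[k] l)
    omega

theorem bitVal_hornerStep (s : ℕ) (l v : List Bool) :
    bitVal (hornerStep s l v) = 2 ^ s * bitVal v + bitVal l := by
  rw [hornerStep, bitVal_addCarry, bitVal_replicate_false_append]
  simp

theorem bitVal_iterate_hornerStep (s k : ℕ) (l : List Bool) :
    bitVal ((hornerStep s l)^[k] l) = (∑ t ∈ Finset.range (k + 1), (2 ^ s) ^ t) * bitVal l := by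
  induction k with
  | zero => simp
  | succ k ih =>
    rw [Function.iterate_succ_apply', bitVal_hornerStep, ih, Finset.sum_range_succ' _ (k + 1)]
    simp only [pow_succ _ (_ : ℕ), ← Finset.sum_mul]
    ring

end BitFrag

open BitFrag

/-- A bound for the size of all intermediate results. -/
def sizeBound (n B : ℕ) : ℕ := B * n + B + n * (1 + n * (B * n + 1)) + (1 + n * (B * n + 1)) + B * n

/-- In one round, adding the new coefficient costs at most one carry bit beyond max(Bn + B, old
length), and each of the n Horner steps adds at most Bn + 1 bits. -/
theorem length_arrAt_le {n B : ℕ} {d : ℕ → List Bool} (hd : ∀ j, 1 ≤ j → j ≤ n → (d j).length ≤ B)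
    {i : ℕ} (hi : i ≤ n) :
    (arrAt n B d i).length ≤ B * n + B + i * (1 + n * (B * n + 1)) := by
  induction i with
  | zero => simp [arrAt]
  | succ i ih =>
    have h₁ := ih (by omega)
    have h₂ := hd (n - i) (by omega) (by omega)
    have h₃ := length_hornerStep_le (B * (n - i)) (arrAt n B d i) (d (n - i))
    have h₄ := length_iterate_hornerStep_le (B * (n - i)) n
      (hornerStep (B * (n - i)) (arrAt n B d i) (d (n - i)))
    have h₅ : B * (n - i) ≤ B * n := Nat.mul_le_mul_left B (Nat.sub_le n i)
    have h₆ : n * (B * (n - i) + 1) ≤ n * (B * n + 1) := Nat.mul_le_mul_left n (by omega)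
    rw [arrAt, nextArr, Nat.succ_mul]
    omega

theorem length_acc_le {n B : ℕ} {d : ℕ → List Bool} (hd : ∀ j, 1 ≤ j → j ≤ n → (d j).length ≤ B)
    {i k : ℕ} (hi : i < n) (hk : k ≤ n) :
    B * (n - i) +
      ((hornerStep (B * (n - i)) (hornerStep (B * (n - i)) (arrAt n B d i) (d (n - i))))^[k]
        (hornerStep (B * (n - i)) (arrAt n B d i) (d (n - i)))).length ≤ sizeBound n B := by
  have h₁ := length_arrAt_le hd hi.le
  have h₂ := hd (n - i) (by omega) (by omega)
  have h₃ := length_hornerStep_le (B * (n - i)) (arrAt n B d i) (d (n - i))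
  have h₄ := length_iterate_hornerStep_le (B * (n - i)) k
    (hornerStep (B * (n - i)) (arrAt n B d i) (d (n - i)))
  have h₅ : B * (n - i) ≤ B * n := Nat.mul_le_mul_left B (Nat.sub_le n i)
  have h₆ : k * (B * (n - i) + 1) ≤ n * (B * n + 1) := Nat.mul_le_mul hk (by omega)
  have h₇ : i * (1 + n * (B * n + 1)) ≤ n * (1 + n * (B * n + 1)) := Nat.mul_le_mul_right _ hi.le
  unfold sizeBound
  omega

open Polynomial in
/-- The polynomial whose coefficients are the entries of the array after `i` rounds. -/
noncomputable def arrPoly (n : ℕ) (g : ℕ → ℕ) : ℕ → ℕ[X]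
  | 0 => 0
  | i + 1 => (∑ t ∈ Finset.range (n + 1), (X ^ (n - i)) ^ t) *
      (X ^ (n - i) * C (g (n - i)) + arrPoly n g i)

/-- Kronecker substitution: the algorithm works on integers, its correctness is proved for
polynomials. -/
theorem bitVal_arrAt (n B : ℕ) (d : ℕ → List Bool) (i : ℕ) :
    bitVal (arrAt n B d i) = (arrPoly n (fun j => bitVal (d j)) i).eval (2 ^ B) := by
  induction i with
  | zero => simp [arrAt, arrPoly, bitVal]
  | succ i ih =>
    rw [arrAt, nextArr, bitVal_iterate_hornerStep, bitVal_hornerStep, ih, arrPoly]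
    simp [Polynomial.eval_finsetSum, pow_mul]

/-- Coefficients beyond index `n` are unrestricted, as they contribute multiples of x^(n+1). The
induction splits off the constant coefficient, which is the remainder modulo x. -/
theorem Polynomial.eval_div_pow_mod (Q : Polynomial ℕ) (x n : ℕ) (h : ∀ m ≤ n, Q.coeff m < x) :
    Q.eval x / x ^ n % x = Q.coeff n := by
  induction n generalizing Q with
  | zero =>
    conv_lhs => rw [← Q.divX_mul_X_add]
    simpa using Nat.mod_eq_of_lt (h 0 le_rfl)
  | succ n ih =>
    have h₀ := h 0 (Nat.zero_le _)
    have h₁ := ih Q.divX (fun m hm => by simpa [Polynomial.coeff_divX] using h (m + 1) (by omega))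
    rw [Polynomial.coeff_divX] at h₁
    rw [← h₁, pow_succ', ← Nat.div_div_eq_div_mul]
    congr 2
    conv_lhs => rw [← Q.divX_mul_X_add]
    simp only [Polynomial.eval_add, Polynomial.eval_mul, Polynomial.eval_X, Polynomial.eval_C]
    rw [Nat.add_comm, Nat.add_mul_div_right _ _ (by omega), Nat.div_eq_of_lt h₀, Nat.zero_add]

/-! ## Counting partitions by the number of parts -/

/-- The number of partitions of `n` into exactly `k` parts. -/
def partCount (n k : ℕ) : ℕ :=
  (Finset.univ.filter fun p : n.Partition => p.parts.card = k).card

theorem Nat.Partition.card_parts_le {n : ℕ} (p : n.Partition) : p.parts.card ≤ n := by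
  have := Multiset.card_nsmul_le_sum (s := p.parts) (a := 1) fun i hi => p.parts_pos hi
  simpa [p.parts_sum] using this

theorem partCount_eq_zero {n k : ℕ} (h : n < k) : partCount n k = 0 := by
  rw [partCount, Finset.card_eq_zero, Finset.filter_eq_empty_iff]
  intro p _ hp
  have := p.card_parts_le
  omega

theorem partCount_zero_right (n : ℕ) : partCount n 0 = if n = 0 then 1 else 0 := by
  rcases n.eq_zero_or_pos with rfl | hn
  · simp [partCount]
  · rw [if_neg hn.ne', partCount, Finset.card_eq_zero, Finset.filter_eq_empty_iff]
    intro p _ hp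
    rw [Multiset.card_eq_zero] at hp
    have := p.parts_sum
    rw [hp, Multiset.sum_zero] at this
    omega

/-- If 1 is a part, remove one copy of it; otherwise subtract 1 from each of the j + 1 parts. -/
theorem partCount_succ_succ (m j : ℕ) :
    partCount (m + j + 1) (j + 1) = partCount (m + j) j + partCount m (j + 1) := by
  rw [partCount, ← Finset.card_filter_add_card_filter_not (fun p => 1 ∈ p.parts),
    Finset.filter_filter, Finset.filter_filter]
  congr 1
  · symm
    refine Finset.card_bij (fun q _ => ⟨1 ::ₘ q.parts, ?_, ?_⟩) ?_ ?_ ?_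
    · intro i hi
      rcases Multiset.mem_cons.mp hi with rfl | hi
      · exact Nat.one_pos
      · exact q.parts_pos hi
    · simp [q.parts_sum, add_comm]
    · intro q hq
      simpa using hq
    · intro q _ q' _ h
      ext1
      simpa using h
    · intro p hp
      simp only [Finset.mem_filter, Finset.mem_univ, true_and] at hp
      have hc := Multiset.cons_erase hp.2
      refine ⟨⟨p.parts.erase 1, fun hi => p.parts_pos (Multiset.mem_of_mem_erase hi), ?_⟩, ?_, ?_⟩
      · have := p.parts_sum
        rw [← hc, Multiset.sum_cons] at this
        omega
      · have := hp.1
        rw [← hc, Multiset.card_cons] at this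
        simpa using this
      · ext1
        exact hc
  · symm
    refine Finset.card_bij (fun q hq => ⟨q.parts.map (· + 1), ?_, ?_⟩) ?_ ?_ ?_
    · intro i hi
      obtain ⟨a, -, rfl⟩ := Multiset.mem_map.mp hi
      omega
    · simp only [Finset.mem_filter, Finset.mem_univ, true_and] at hq
      simp [Multiset.sum_map_add, q.parts_sum, hq]
      omega
    · intro q hq
      simp only [Finset.mem_filter, Finset.mem_univ, true_and] at hq ⊢
      refine ⟨by simpa using hq, ?_⟩
      intro h
      obtain ⟨a, ha, h⟩ := Multiset.mem_map.mp h
      have := q.parts_pos ha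
      omega
    · intro q _ q' _ h
      ext1
      have := congrArg Nat.Partition.parts h
      exact Multiset.map_injective (add_left_injective 1) this
    · intro p hp
      simp only [Finset.mem_filter, Finset.mem_univ, true_and] at hp
      have hm : (p.parts.map (· - 1)).map (· + 1) = p.parts := by
        rw [Multiset.map_map]
        conv_rhs => rw [← Multiset.map_id p.parts]
        refine Multiset.map_congr rfl fun i hi => ?_
        have := p.parts_pos hi
        simp; omega
      have hc : (p.parts.map (· - 1)).card = j + 1 := by simpa using hp.1
      refine ⟨⟨p.parts.map (· - 1), ?_, ?_⟩, ?_, ?_⟩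
      · intro i hi
        obtain ⟨a, ha, rfl⟩ := Multiset.mem_map.mp hi
        have := p.parts_pos ha
        have : a ≠ 1 := fun h => hp.2 (h ▸ ha)
        omega
      · have := p.parts_sum
        rw [← hm, Multiset.sum_map_add, Multiset.map_id'] at this
        rw [Multiset.map_const', hc, Multiset.sum_replicate, smul_eq_mul] at this
        omega
      · simpa using hc
      · ext1
        exact hm

theorem sum_partition_eq (g : ℕ → ℕ) (n : ℕ) :
    ∑ p : n.Partition, g p.parts.card = ∑ k ∈ Finset.range (n + 1), g k * partCount n k := by
  rw [← Finset.sum_fiberwise_of_maps_to (g := fun p : n.Partition => p.parts.card)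
    (t := Finset.range (n + 1)) (fun p _ => Finset.mem_range_succ_iff.mpr p.card_parts_le)]
  refine Finset.sum_congr rfl fun k _ => ?_
  rw [Finset.sum_congr rfl (g := fun _ => g k) fun p hp => by rw [(Finset.mem_filter.mp hp).2]]
  rw [Finset.sum_const, smul_eq_mul, mul_comm, partCount]

open PowerSeries in
/-- The generating function of the numbers of partitions of `m + j` into `j` parts. -/
noncomputable def partSeries (j : ℕ) : PowerSeries ℤ := PowerSeries.mk fun m => (partCount (m + j) j : ℤ)

theorem partSeries_zero : partSeries 0 = 1 := by
  ext m
  simp [partSeries, partCount_zero_right, PowerSeries.coeff_one]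

/-- This is `partCount_succ_succ` for generating functions; it makes `partSeries j` the inverse of
(1 - x) ⋯ (1 - x^j). -/
theorem partSeries_succ (j : ℕ) :
    partSeries (j + 1) * (1 - PowerSeries.X ^ (j + 1)) = partSeries j := by
  ext m
  rw [mul_sub, mul_one, map_sub, PowerSeries.coeff_mul_X_pow']
  simp only [partSeries, PowerSeries.coeff_mk]
  have h := partCount_succ_succ m j
  rw [add_assoc] at h
  split_ifs with hm
  · rw [Nat.sub_add_cancel hm, h]; push_cast; ring
  · rw [h, partCount_eq_zero (by omega : m < j + 1)]; simp

theorem coeff_X_pow_mul_partSeries (m k : ℕ) :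
    PowerSeries.coeff m ((PowerSeries.X : PowerSeries ℤ) ^ k * partSeries k) = partCount m k := by
  rw [PowerSeries.coeff_X_pow_mul']
  split_ifs with h
  · simp [partSeries, Nat.sub_add_cancel h]
  · rw [partCount_eq_zero (by omega)]; simp

/-- The inclusion of polynomials into power series. -/
noncomputable def polySeries : Polynomial ℕ →+* PowerSeries ℤ :=
  Polynomial.coeToPowerSeries.ringHom.comp (Polynomial.mapRingHom (Nat.castRingHom ℤ))

theorem coeff_polySeries (Q : Polynomial ℕ) (m : ℕ) :
    PowerSeries.coeff m (polySeries Q) = Q.coeff m := by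
  simp [polySeries]

/-- The loop invariant of Horner's rule modulo x^(n+1): the terms with index above n - i have been
absorbed in the polynomial, up to the common factor `partSeries (n - i)`. -/
theorem dvd_arrPoly_sub (n : ℕ) (g : ℕ → ℕ) {i : ℕ} (hi : i ≤ n) :
    (PowerSeries.X ^ (n + 1) : PowerSeries ℤ) ∣ polySeries (arrPoly n g i) * partSeries (n - i) +
      ∑ k ∈ Finset.range (n - i), (g (k + 1) : PowerSeries ℤ) *
        (PowerSeries.X ^ (k + 1) * partSeries (k + 1)) -
      ∑ k ∈ Finset.range n, (g (k + 1) : PowerSeries ℤ) *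
        (PowerSeries.X ^ (k + 1) * partSeries (k + 1)) := by
  induction i with
  | zero => simp [arrPoly]
  | succ i ih =>
    obtain ⟨j, hj⟩ : ∃ j, j = n - (i + 1) := ⟨_, rfl⟩
    have hj' : n - i = j + 1 := by omega
    have h := ih (by omega)
    rw [hj', Finset.sum_range_succ] at h
    rw [← hj]
    generalize ∑ k ∈ Finset.range n, (g (k + 1) : PowerSeries ℤ) *
        (PowerSeries.X ^ (k + 1) * partSeries (k + 1)) = S at *
    have hX : polySeries Polynomial.X = PowerSeries.X := by simp [polySeries]
    have hC : polySeries (Polynomial.C (g (j + 1))) = (g (j + 1) : PowerSeries ℤ) := by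
      simp [polySeries]
    rw [arrPoly, hj']
    simp only [map_mul, map_add, map_sum, map_pow, hX, hC]
    -- The truncated geometric series inverts 1 - x^(j+1) up to x^((j+1)(n+1)), which vanishes
    -- modulo x^(n+1).
    have hE := mul_neg_geom_sum (PowerSeries.X ^ (j + 1) : PowerSeries ℤ) (n + 1)
    rw [← partSeries_succ j]
    have hd : (PowerSeries.X ^ (n + 1) : PowerSeries ℤ) ∣ (PowerSeries.X ^ (j + 1)) ^ (n + 1) := by
      rw [← pow_mul]
      exact pow_dvd_pow _ (by nlinarith)
    generalize ∑ t ∈ Finset.range (n + 1), ((PowerSeries.X ^ (j + 1) : PowerSeries ℤ)) ^ t = E at *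
    refine (dvd_sub h (hd.mul_right ((PowerSeries.X ^ (j + 1) * (g (j + 1) : PowerSeries ℤ) +
      polySeries (arrPoly n g i)) * partSeries (j + 1)))).trans (dvd_of_eq ?_)
    linear_combination (-((PowerSeries.X ^ (j + 1) * (g (j + 1) : PowerSeries ℤ) +
      polySeries (arrPoly n g i)) * partSeries (j + 1))) * hE

theorem coeff_arrPoly (n : ℕ) (g : ℕ → ℕ) (hg : g 0 = 0) {m : ℕ} (hm : m ≤ n) :
    (arrPoly n g n).coeff m = ∑ p : m.Partition, g p.parts.card := by
  have h := PowerSeries.X_pow_dvd_iff.mp (dvd_arrPoly_sub n g le_rfl) m (by omega)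
  simp only [Nat.sub_self, partSeries_zero, mul_one, Finset.range_zero, Finset.sum_empty, add_zero,
    map_sub, coeff_polySeries, map_sum, sub_eq_zero] at h
  have h₁ : ∀ k, PowerSeries.coeff m ((g k : PowerSeries ℤ) *
      (PowerSeries.X ^ k * partSeries k)) = ((g k * partCount m k : ℕ) : ℤ) := fun k => by
    rw [← map_natCast (PowerSeries.C (R := ℤ)), PowerSeries.coeff_C_mul, coeff_X_pow_mul_partSeries]
    push_cast; rfl
  simp only [h₁] at h
  norm_cast at h
  rw [h, sum_partition_eq]
  have h₂ : ∑ k ∈ Finset.range (m + 1), g k * partCount m k =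
      ∑ k ∈ Finset.range (n + 1), g k * partCount m k := by
    refine Finset.sum_subset (fun k hk => ?_) fun k _ hk => ?_
    · simp only [Finset.mem_range] at hk ⊢; omega
    · rw [partCount_eq_zero (by simpa using hk), mul_zero]
  -- Horner's rule starts at k = 1; the term k = 0, which matters for the empty partition of m = 0,
  -- vanishes because `g 0 = 0`.
  rw [h₂, Finset.sum_range_succ', hg, zero_mul, add_zero]

/-! ## Size estimates -/

theorem card_partition_le (n : ℕ) : Fintype.card n.Partition ≤ 2 ^ n :=
  (Fintype.card_le_of_surjective _ Nat.Partition.ofComposition_surj).trans <|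
    (composition_card n).trans_le (Nat.pow_le_pow_right (by norm_num) (Nat.sub_le n 1))

/-- A subset of {2, ..., √n} has sum at most (√n - 1)√n ≤ n and is padded by ones to a partition of
n. The parts that are at least 2 recover the subset. -/
theorem two_pow_sqrt_le_card_partition (n : ℕ) : 2 ^ (n.sqrt - 1) ≤ Fintype.card n.Partition := by
  have hsum : ∀ S ∈ (Finset.Icc 2 n.sqrt).powerset, S.val.sum ≤ n := by
    intro S hS
    rw [Finset.mem_powerset] at hS
    have h₁ := Finset.sum_le_card_nsmul S id n.sqrt fun i hi => (Finset.mem_Icc.mp (hS hi)).2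
    have h₂ := Finset.card_le_card hS
    rw [Nat.card_Icc] at h₂
    have h₃ : S.val.sum = S.sum id := by
      rw [Finset.sum_eq_multiset_sum, Multiset.map_id]
    rw [h₃]
    refine h₁.trans ((Nat.mul_le_mul_right _ (h₂.trans ?_)).trans (Nat.sqrt_le n))
    omega
  have := Fintype.card_le_of_injective
    (fun S : (Finset.Icc 2 n.sqrt).powerset =>
      (⟨S.1.val + Multiset.replicate (n - S.1.val.sum) 1, fun {i} hi => by
        rcases Multiset.mem_add.mp hi with hi | hi
        · have := (Finset.mem_Icc.mp (Finset.mem_powerset.mp S.2 hi)).1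
          omega
        · rw [Multiset.eq_of_mem_replicate hi]; exact Nat.one_pos, by
        have := hsum S.1 S.2
        rw [Multiset.sum_add, Multiset.sum_replicate, smul_eq_mul, mul_one]
        omega⟩ : n.Partition)) ?_
  · simpa using this
  · intro S S' h
    have h₁ := congrArg (fun p => p.parts.filter (2 ≤ ·)) h
    have h₂ : ∀ S : (Finset.Icc 2 n.sqrt).powerset,
        (S.1.val + Multiset.replicate (n - S.1.val.sum) 1).filter (2 ≤ ·) = S.1.val := by
      intro S
      rw [Multiset.filter_add, Multiset.filter_eq_self.mpr, Multiset.filter_eq_nil.mpr, add_zero]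
      · intro a ha
        rw [Multiset.eq_of_mem_replicate ha]; norm_num
      · intro a ha
        exact (Finset.mem_Icc.mp (Finset.mem_powerset.mp S.2 ha)).1
    simp only [h₂] at h₁
    exact Subtype.ext (Finset.val_injective h₁)

theorem exists_partition_card_eq {n k : ℕ} (hk : 1 ≤ k) (hkn : k ≤ n) :
    ∃ p : n.Partition, p.parts.card = k := by
  refine ⟨⟨(n - k + 1) ::ₘ Multiset.replicate (k - 1) 1, fun {i} hi => ?_, ?_⟩, ?_⟩
  · rcases Multiset.mem_cons.mp hi with rfl | hi
    · omega
    · rw [Multiset.eq_of_mem_replicate hi]; exact Nat.one_pos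
  · simp; omega
  · simp; omega

/-- For x ≥ 1 every power is at most the top one, so `C` can be the sum of the coefficients. -/
theorem Polynomial.exists_eval_le (p : Polynomial ℕ) :
    ∃ C D : ℕ, ∀ x, 1 ≤ x → p.eval x ≤ C * x ^ D := by
  refine ⟨p.eval 1, p.natDegree, fun x hx => ?_⟩
  rw [Polynomial.eval_eq_sum_range, Polynomial.eval_eq_sum_range, Finset.sum_mul]
  refine Finset.sum_le_sum fun i hi => ?_
  rw [one_pow, mul_one]
  exact Nat.mul_le_mul_left _ (Nat.pow_le_pow_right hx (Finset.mem_range_succ_iff.mp hi))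

theorem sizeBound_mono {n n' B B' : ℕ} (hn : n ≤ n') (hB : B ≤ B') :
    sizeBound n B ≤ sizeBound n' B' := by
  unfold sizeBound
  gcongr

theorem pioSize_natCast (g : ℕ+ → ℕ+) (n : ℕ+) :
    pioSize (fun n => ((g n : ℕ) : ℤ)) n = Real.log (1 + (n : ℕ)) + Real.log (2 + (g n : ℕ)) := by
  simp [pioSize]

theorem pioSize_le_pioSize {g f : ℕ+ → ℕ+} {j n : ℕ+} (hj : j ≤ n) (h : g j ≤ f n) :
    pioSize (fun n => ((g n : ℕ) : ℤ)) j ≤ pioSize (fun n => ((f n : ℕ) : ℤ)) n := by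
  rw [pioSize_natCast, pioSize_natCast]
  have h₁ : ((j : ℕ) : ℝ) ≤ (n : ℕ) := by exact_mod_cast hj
  have h₂ : ((g j : ℕ) : ℝ) ≤ (f n : ℕ) := by exact_mod_cast h
  gcongr

theorem one_le_pioSize (f : ℕ+ → ℕ+) (n : ℕ+) :
    1 ≤ pioSize (fun n => ((f n : ℕ) : ℤ)) n := by
  rw [pioSize_natCast]
  have h₁ : (1 : ℝ) ≤ (n : ℕ) := by exact_mod_cast n.pos
  have h₂ : Real.log 2 ≤ Real.log (1 + (n : ℕ)) := Real.log_le_log (by norm_num) (by linarith)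
  have h₃ : Real.log 2 ≤ Real.log (2 + (f n : ℕ)) := Real.log_le_log (by norm_num) (by
    have : (0 : ℝ) ≤ (f n : ℕ) := Nat.cast_nonneg _
    linarith)
  have := Real.log_two_gt_d9
  linarith

/-- If `2 ^ k ≤ f n`, then `k` is bounded by twice the size. -/
theorem le_two_mul_ceil_pioSize {f : ℕ+ → ℕ+} {n : ℕ+} {k : ℕ} (h : 2 ^ k ≤ (f n : ℕ)) :
    k ≤ 2 * ⌈pioSize (fun n => ((f n : ℕ) : ℤ)) n⌉₊ := by
  have h₁ : (1 : ℝ) ≤ (n : ℕ) := by exact_mod_cast n.pos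
  have h₂ : 0 ≤ Real.log (1 + (n : ℕ)) := Real.log_nonneg (by linarith)
  have h₃ : Real.log (2 ^ k) ≤ Real.log (2 + (f n : ℕ)) := Real.log_le_log (by positivity) (by
    have : (2 : ℝ) ^ k ≤ (f n : ℕ) := by exact_mod_cast h
    linarith)
  rw [Real.log_pow] at h₃
  have h₄ := Nat.le_ceil (pioSize (fun n => ((f n : ℕ) : ℤ)) n)
  have h₅ := pioSize_natCast f n
  have h₆ := Real.log_two_gt_d9
  have h₇ : (k : ℝ) ≤ 2 * ⌈pioSize (fun n => ((f n : ℕ) : ℤ)) n⌉₊ := by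
    have : (k : ℝ) * (1 / 2) ≤ k * Real.log 2 :=
      mul_le_mul_of_nonneg_left (by linarith) (Nat.cast_nonneg k)
    linarith
  exact_mod_cast h₇

/-! ## The main theorem -/

open Frag Work Computability

/-- The machine for sums over partitions, given a machine `M` for the summands. -/
def partitionMachine (M : TM2ComputableAux Bool Bool) : TM2ComputableAux Bool Bool where
  tm :=
    { K := M.tm.K ⊕ Work
      kFin := @instFintypeSum _ _ M.tm.kFin _
      k₀ := .inr cnt
      k₁ := .inr cnt
      Γ := WithBits M.tm.Γ Work
      Λ := (partitionProgram M).Λ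
      main := (partitionProgram M).main
      ΛFin := (partitionProgram M).fin
      σ := M.tm.σ × Reg
      initialState := default
      σFin := @instFintypeProd _ _ M.tm.σFin _
      Γk₀Fin := inferInstanceAs (Fintype Bool)
      m := (partitionProgram M).m }
  inputAlphabet := Equiv.refl Bool
  outputAlphabet := Equiv.refl Bool

theorem partitionMachine_outputs {M : TM2ComputableAux Bool Bool} {l l' : List Bool} {t : ℕ}
    (h : (partitionProgram M).Runs (Store.full M { cnt := l }) (Store.full M { cnt := l' }) t) :
    Nonempty (TM2OutputsInTime (partitionMachine M).tm
      (l.map (partitionMachine M).inputAlphabet.symm)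
      (some (l'.map (partitionMachine M).outputAlphabet.symm)) t) := by
  have e : ∀ l : List Bool, Store.full M { cnt := l } =
      Function.update (β := fun k => List (WithBits M.tm.Γ Work k)) (fun _ => []) (.inr cnt) l := by
    intro l
    funext k
    rcases k with k | k
    · rfl
    · cases k <;> rfl
  rw [e, e] at h
  refine ((partitionMachine M).tm.toFrag_runs_iff _ _ t).mp ?_
  have e' : ∀ l : List Bool, l.map (Equiv.refl Bool).symm = l := by simp
  exact (e' l).symm ▸ (e' l').symm ▸ h

/-- Each code contributes its digits and one extra bit to the width. The digits alone, B - n in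
number, bound every g(j) by 2^(B-n); the n extra bits absorb the at most 2^n partitions. -/
theorem sum_lt_two_pow_widthAt {g : ℕ → ℕ} {n m : ℕ} (hm : m ≤ n) (hg : g 0 = 0) :
    ∑ p : m.Partition, g p.parts.card < 2 ^ widthAt n (fun j => encodeNat (g j)) n := by
  set B := widthAt n (fun j => encodeNat (g j)) n with hB
  have hB' : B = ∑ k ∈ Finset.range n, (encodeNat (g (n - k))).length + n := by
    simp [hB, widthAt, Finset.sum_add_distrib]
  have hgB : ∀ j ≤ n, g j < 2 ^ (B - n) := by
    intro j hj
    rcases j.eq_zero_or_pos with rfl | hj'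
    · rw [hg]; positivity
    · have h₁ := Finset.single_le_sum (f := fun k => (encodeNat (g (n - k))).length)
        (fun _ _ => Nat.zero_le _) (Finset.mem_range.mpr (show n - j < n by omega))
      simp only [show n - (n - j) = j by omega] at h₁
      have h₂ := bitVal_lt (encodeNat (g j))
      rw [bitVal_encodeNat] at h₂
      exact h₂.trans_le (Nat.pow_le_pow_right (by norm_num) (by omega))
  calc ∑ p : m.Partition, g p.parts.card < ∑ _p : m.Partition, 2 ^ (B - n) :=
        Finset.sum_lt_sum_of_nonempty Finset.univ_nonempty
          fun p _ => hgB _ (p.card_parts_le.trans hm)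
    _ = Fintype.card m.Partition * 2 ^ (B - n) := by simp
    _ ≤ 2 ^ n * 2 ^ (B - n) := Nat.mul_le_mul_right _
        ((card_partition_le m).trans (Nat.pow_le_pow_right (by norm_num) hm))
    _ = 2 ^ B := by rw [← pow_add]; congr 1; omega

/-- The time bound depends only on the upper bounds `N`, `T`, `D`, which can later be replaced by
polynomials in the size m_f(n). -/
theorem partitionMachine_outputs_sum {M : TM2ComputableAux Bool Bool} {g : ℕ → ℕ} (hg : g 0 = 0)
    {n N T D : ℕ} (hn : n ≤ N)
    (hM : ∀ j, 1 ≤ j → j ≤ n → Nonempty (TM2OutputsInTime M.tm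
      ((encodeNat j).map M.inputAlphabet.symm)
      (some ((false :: encodeNat (g j)).map M.outputAlphabet.symm)) T))
    (hD : ∀ j, 1 ≤ j → j ≤ n → (encodeNat (g j)).length ≤ D) :
    Nonempty (TM2OutputsInTime (partitionMachine M).tm
      ((encodeNat n).map (partitionMachine M).inputAlphabet.symm)
      (some ((false :: encodeNat (∑ p : n.Partition, g p.parts.card)).map
        (partitionMachine M).outputAlphabet.symm))
      (100 * (N + 1) * (T + (N + 1) * (sizeBound N (N * (D + 1)) + N + 1)))) := by
  set d := fun j => encodeNat (g j)
  set B := widthAt n d n with hB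
  have hdB : ∀ j, 1 ≤ j → j ≤ n → (d j).length + 1 ≤ B := by
    intro j hj hjn
    have h₁ := Finset.single_le_sum (f := fun k => (d (n - k)).length + 1)
      (fun _ _ => Nat.zero_le _) (Finset.mem_range.mpr (show n - j < n by omega))
    simp only [show n - (n - j) = j by omega] at h₁
    exact h₁
  have hBD : B ≤ N * (D + 1) := by
    refine (Finset.sum_le_card_nsmul _ _ (D + 1) fun k hk => ?_).trans ?_
    · have := Finset.mem_range.mp hk
      exact Nat.add_le_add_right (hD _ (by omega) (by omega)) 1
    · simpa using Nat.mul_le_mul_right (D + 1) hn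
  have hd : ∀ j, 1 ≤ j → j ≤ n → (d j).length ≤ B := fun j h h' => (Nat.le_succ _).trans (hdB j h h')
  have hs : sizeBound n B ≤ sizeBound N (N * (D + 1)) := sizeBound_mono hn hBD
  have hBs : B ≤ sizeBound n B := by unfold sizeBound; omega
  have key := partitionProgram_runs (M := M) (d := d) (n := n) (T := T) (B := B)
    -- The summand `N` makes room for the binary counters j ≤ n, whose codes have length at most j.
    (L := sizeBound N (N * (D + 1)) + N) hB hM (fun j h h' => by have := hdB j h h'; omega)
    (fun j hj => ?_) (by omega)
    (fun i hi => ?_) (fun i hi k hk => by have := length_acc_le hd hi hk; omega)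
  · have hval : bitVal (arrAt n B d n) / 2 ^ (B * n) % 2 ^ B = ∑ p : n.Partition, g p.parts.card := by
      have hg' : (fun j => bitVal (d j)) = g := funext fun j => bitVal_encodeNat (g j)
      rw [bitVal_arrAt, hg', pow_mul, Polynomial.eval_div_pow_mod, coeff_arrPoly n g hg le_rfl]
      intro m hm
      rw [coeff_arrPoly n g hg hm]
      exact sum_lt_two_pow_widthAt hm hg
    rw [hval] at key
    refine partitionMachine_outputs (key.mono ?_)
    gcongr
  · rcases j.eq_zero_or_pos with rfl | hj'
    · simp [encodeNat_zero]
    · have h₁ := two_pow_length_encodeNat_le hj'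
      have h₂ : 2 * j ≤ 2 ^ j := by
        obtain ⟨i, rfl⟩ : ∃ i, j = i + 1 := ⟨j - 1, by omega⟩
        have := Nat.lt_two_pow_self (n := i)
        rw [pow_succ]; omega
      have := (Nat.pow_le_pow_iff_right (by norm_num : 1 < 2)).mp (h₁.trans h₂)
      omega
  · have h₁ := length_arrAt_le hd hi
    have h₂ : i * (1 + n * (B * n + 1)) ≤ n * (1 + n * (B * n + 1)) := Nat.mul_le_mul_right _ hi
    have h₃ : sizeBound n B ≤ sizeBound N (N * (D + 1)) := hs
    unfold sizeBound at h₃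
    unfold sizeBound
    omega

theorem encodeInt_natCast (n : ℕ) : encodeInt n = false :: encodeNat n := by
  simp [encodeInt]

/-- If `g` is a PIO function from the positive integers to the positive integers, then so is
`f n = ∑ g ‖p‖`, the sum over all partitions `p` of `n`. -/
theorem mainTheorem4 (g : ℕ+ → ℕ+) (hg : IsPIO (fun n => ((g n : ℕ) : ℤ))) :
    ∃ f : ℕ+ → ℕ+,
      (∀ n : ℕ+, (f n : ℕ) = ∑ p : Nat.Partition n, (g (numParts p) : ℕ)) ∧
      IsPIO (fun n => ((f n : ℕ) : ℤ)) := by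
  obtain ⟨M, c, e, -, -, hΓ, hM⟩ := hg
  set f : ℕ+ → ℕ+ := fun n => ⟨∑ p : Nat.Partition n, (g (numParts p) : ℕ),
    Finset.sum_pos (fun p _ => (g (numParts p)).pos) Finset.univ_nonempty⟩ with hf
  refine ⟨f, fun n => rfl, ?_⟩
  have hgf : ∀ j n : ℕ+, j ≤ n → g j ≤ f n := by
    intro j n hjn
    obtain ⟨p, hp⟩ := exists_partition_card_eq j.pos hjn
    have hpj : numParts p = j := PNat.coe_injective hp
    have := Finset.single_le_sum (f := fun p : Nat.Partition n => (g (numParts p) : ℕ))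
      (fun _ _ => Nat.zero_le _) (Finset.mem_univ p)
    simp only [hpj] at this
    exact this
  have hpf : ∀ n : ℕ+, Fintype.card (Nat.Partition n) ≤ f n := by
    intro n
    have := Finset.card_nsmul_le_sum Finset.univ (fun p : Nat.Partition n => (g (numParts p) : ℕ)) 1
      fun p _ => (g (numParts p)).pos
    rw [Finset.card_univ, smul_eq_mul, mul_one] at this
    exact this
  -- The value 0 at 0 is the convention required by `coeff_arrPoly`; partitions of a positive number
  -- never use it.
  set G : ℕ → ℕ := fun j => if j = 0 then 0 else g j.toPNat' with hG
  have hGj : ∀ j : ℕ+, G j = g j := fun j => by simp [hG]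
  have hfG : ∀ n : ℕ+, (f n : ℕ) = ∑ p : Nat.Partition n, G p.parts.card := fun n =>
    (show (f n : ℕ) = ∑ p : Nat.Partition n, (g (numParts p) : ℕ) from rfl).trans <|
      Finset.sum_congr rfl fun p _ => (hGj (numParts p)).symm
  set ℓ : ℕ+ → ℕ := fun n => ⌈pioSize (fun n => ((f n : ℕ) : ℤ)) n⌉₊ with hℓ
  have hℓ1 : ∀ n, 1 ≤ ℓ n := fun n =>
    Nat.one_le_ceil_iff.mpr (zero_lt_one.trans_le (one_le_pioSize f n))
  have hN : ∀ n : ℕ+, (n : ℕ) ≤ 16 * ℓ n ^ 2 := by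
    intro n
    have h₁ := le_two_mul_ceil_pioSize ((two_pow_sqrt_le_card_partition n).trans (hpf n))
    have h₂ := Nat.lt_succ_sqrt' (n : ℕ)
    have h₃ := hℓ1 n
    -- From √n - 1 ≤ 2ℓ and ℓ ≥ 1 follows √n + 1 ≤ 4ℓ, and n < (√n + 1)^2.
    have h₄ : (n : ℕ).sqrt.succ ≤ 4 * ℓ n := by simp only [hℓ] at *; omega
    nlinarith
  have hD : ∀ n : ℕ+, ∀ j, 1 ≤ j → j ≤ (n : ℕ) → (encodeNat (G j)).length ≤ 3 * ℓ n := by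
    intro n j hj hjn
    obtain ⟨j, rfl⟩ : ∃ i : ℕ+, (i : ℕ) = j := ⟨⟨j, hj⟩, rfl⟩
    have h₁ : G j = g j := hGj j
    have h₂ : (g j : ℕ) ≤ f n := hgf j n hjn
    have h₃ := two_pow_length_encodeNat_le (n := G j) (by rw [h₁]; exact PNat.pos _)
    have h₄ := hℓ1 n
    rcases Nat.eq_zero_or_pos (encodeNat (G j)).length with h₅ | h₅
    · omega
    -- If the code has length λ, then 2^λ ≤ 2 g(j) ≤ 2 f(n), so λ - 1 ≤ 2ℓ.
    · have h₆ : 2 ^ ((encodeNat (G j)).length - 1) ≤ (f n : ℕ) := by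
        obtain ⟨i, hi⟩ : ∃ i, (encodeNat (G (j : ℕ))).length = i + 1 := ⟨_, (Nat.sub_add_cancel h₅).symm⟩
        rw [hi, pow_succ] at h₃
        rw [hi, Nat.add_sub_cancel]
        omega
      have h₇ := le_two_mul_ceil_pioSize h₆
      simp only [hℓ] at *
      omega
  have hT : ∀ n : ℕ+, ∀ j, 1 ≤ j → j ≤ (n : ℕ) → Nonempty (TM2OutputsInTime M.tm
      ((encodeNat j).map M.inputAlphabet.symm)
      (some ((false :: encodeNat (G j)).map M.outputAlphabet.symm)) (c * ℓ n ^ e)) := by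
    intro n j hj hjn
    obtain ⟨j, rfl⟩ : ∃ i : ℕ+, (i : ℕ) = j := ⟨⟨j, hj⟩, rfl⟩
    obtain ⟨t, ht, ⟨h⟩⟩ := hM j
    rw [encodeInt_natCast, ← hGj] at h
    refine ⟨⟨h.toEvalsTo, h.steps_le_m.trans ?_⟩⟩
    have h₁ := pioSize_le_pioSize (f := f) (g := g) hjn (hgf _ _ hjn)
    have h₂ := zero_le_one.trans (one_le_pioSize g j)
    have h₃ : (t : ℝ) ≤ c * (ℓ n : ℝ) ^ e := ht.trans <| mul_le_mul_of_nonneg_left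
      (pow_le_pow_left₀ h₂ (h₁.trans (Nat.le_ceil _)) e) (Nat.cast_nonneg c)
    exact_mod_cast h₃
  -- This is the time bound with N = 16x^2, T = cx^e and code length 3x substituted: a polynomial in
  -- x = ℓ.
  obtain ⟨C, D, hCD⟩ : ∃ C D : ℕ, ∀ x, 1 ≤ x → 100 * (16 * x ^ 2 + 1) * (c * x ^ e +
      (16 * x ^ 2 + 1) * (sizeBound (16 * x ^ 2) (16 * x ^ 2 * (3 * x + 1)) + 16 * x ^ 2 + 1)) ≤
      C * x ^ D := by
    open Polynomial in
    obtain ⟨C, D, h⟩ := Polynomial.exists_eval_le (100 * (16 * X ^ 2 + 1) * (C c * X ^ e +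
      (16 * X ^ 2 + 1) * ((16 * X ^ 2 * (3 * X + 1)) * (16 * X ^ 2) + (16 * X ^ 2 * (3 * X + 1)) +
        (16 * X ^ 2) * (1 + (16 * X ^ 2) * ((16 * X ^ 2 * (3 * X + 1)) * (16 * X ^ 2) + 1)) +
        (1 + (16 * X ^ 2) * ((16 * X ^ 2 * (3 * X + 1)) * (16 * X ^ 2) + 1)) +
        (16 * X ^ 2 * (3 * X + 1)) * (16 * X ^ 2) + 16 * X ^ 2 + 1)))
    refine ⟨C, D, fun x hx => ?_⟩
    have := h x hx
    simpa [sizeBound] using this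
  -- The factor 2^D comes from ℓ ≤ 2 m_f(n), as the ceiling is less than m_f(n) + 1 and m_f(n) ≥ 1.
  -- The added ones make both constants positive.
  refine ⟨partitionMachine M, C * 2 ^ D + 1, D + 1, by positivity, by positivity, ?_, fun n => ?_⟩
  · rintro (k | k)
    · exact hΓ k
    · exact inferInstanceAs (Finite Bool)
  · have h := partitionMachine_outputs_sum (M := M) (g := G) (by simp [hG]) (hN n) (hT n) (hD n)
    rw [← hfG] at h
    refine ⟨_, ?_, by rw [encodeInt_natCast]; exact h⟩
    have h₁ := hCD (ℓ n) (hℓ1 n)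
    have h₂ := one_le_pioSize f n
    have h₃ : (ℓ n : ℝ) ≤ 2 * pioSize (fun n => ((f n : ℕ) : ℤ)) n := by
      have := Nat.ceil_lt_add_one (zero_le_one.trans h₂)
      simp only [hℓ]
      linarith
    generalize pioSize (fun n => ((f n : ℕ) : ℤ)) n = S at *
    refine (Nat.cast_le.mpr h₁).trans ?_
    push_cast
    calc (C : ℝ) * (ℓ n : ℝ) ^ D ≤ C * (2 * S) ^ D := by gcongr
      _ = C * 2 ^ D * S ^ D := by ring
      _ ≤ (C * 2 ^ D + 1) * S ^ (D + 1) := by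
        gcongr
        · linarith
        · omega
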